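/- All graphs are finite and simple. A matching $M$ in a graph $G$ is a set of pairwise vertex-disjoint edges; it is *uniquely restricted* if no other matching of $G$ matches exactly the same set of vertices as $M$. A graph $G$ is a *proper interval graph* if one can assign to each vertex $v$ a closed interval $I_v=[a_v,b_v]\subset\mathbb{R}$ with $a_v\le b_v$ such that distinct vertices $u,v$ are adjacent if and only if $I_u\cap I_v\neq\emptyset$, and no interval $I_u$ is strictly contained in another interval $I_v$. **Theorem.** There is a linear-time algorithm that computes a maximum cardinality uniquely restricted matching in a given proper interval graph. Precisely: there are a random access machine program $P$ (with addition, subtraction, comparison and indirect addressing as unit-cost operations) and a constant $c$ such that, for every proper interval graph $G$ with vertex set $\{0,\dots,n-1\}$ and $m$ edges, given by $n$ and an adjacency list (the neighbours of each vertex in arbitrary order), the program $P$ halts within $c\,(n+m+1)$ steps, uses no number (memory content, address or intermediate result) larger than $c\,(n+m+1)$, and outputs a list, without repetitions, of the edges of a uniquely restricted matching of $G$ whose cardinality is maximum among all uniquely restricted matchings of $G$. -/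

import Mathlib

/-! ### Proper interval graphs and uniquely restricted matchings -/

/-- `G` has a proper interval representation: a family of nonempty closed intervals
`[l v, r v]` of the real line, one for each vertex, such that two distinct vertices are adjacent
exactly when their intervals meet, and no interval is strictly contained in another one. -/
def SimpleGraph.IsProperInterval {V : Type*} (G : SimpleGraph V) : Prop :=
  ∃ l r : V → ℝ,
    (∀ v, l v ≤ r v) ∧
    (∀ u v, u ≠ v →
      (G.Adj u v ↔ (Set.Icc (l u) (r u) ∩ Set.Icc (l v) (r v)).Nonempty)) ∧
    (∀ u v, ¬ Set.Icc (l u) (r u) ⊂ Set.Icc (l v) (r v))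

/-- A matching `M` of `G` is uniquely restricted if it is the only matching of `G` that matches
the set of vertices matched by `M`.  (A set of pairwise disjoint edges of `G` is the same thing as
a subgraph that satisfies Mathlib's `SimpleGraph.Subgraph.IsMatching`; the vertices of this
subgraph are the vertices matched.) -/
def SimpleGraph.Subgraph.IsUniquelyRestricted {V : Type*} {G : SimpleGraph V}
    (M : G.Subgraph) : Prop :=
  M.IsMatching ∧ ∀ M' : G.Subgraph, M'.IsMatching → M'.verts = M.verts → M' = M

/-- `M` is a uniquely restricted matching with the largest number of edges. -/
def SimpleGraph.Subgraph.IsMaximumUniquelyRestricted {V : Type*} {G : SimpleGraph V}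
    (M : G.Subgraph) : Prop :=
  M.IsUniquelyRestricted ∧
    ∀ M' : G.Subgraph, M'.IsUniquelyRestricted → M'.edgeSet.ncard ≤ M.edgeSet.ncard

/-! ### Random access machine

Programs for a random access machine with bounded word size, in structured form.  A program uses
finitely many registers and finitely many arrays (both named by natural numbers), all of whose
cells hold natural numbers.  Every elementary operation costs one unit of time, and a run is only
defined if no number larger than a bound `W` (the largest machine word) ever comes up. -/

namespace RAM

/-- Expressions.  `get a i` reads the cell with index `i` of the array `a`. -/
inductive Expr : Type
  | const (k : ℕ)
  | reg (x : ℕ)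
  | get (a : ℕ) (i : Expr)
  | add (e₁ e₂ : Expr)
  | sub (e₁ e₂ : Expr)
  | lt (e₁ e₂ : Expr)
  | eq (e₁ e₂ : Expr)

/-- Programs. -/
inductive Prog : Type
  | skip
  /-- Put the value of `e` into the register `x`. -/
  | assign (x : ℕ) (e : Expr)
  /-- Put the value of `e` into the cell with index `i` of the array `a`. -/
  | store (a : ℕ) (i e : Expr)
  | seq (p q : Prog)
  /-- Run `p` if the value of `e` is not `0`, otherwise run `q`. -/
  | ite (e : Expr) (p q : Prog)
  /-- Repeat `p` as long as the value of `e` is not `0`. -/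
  | loop (e : Expr) (p : Prog)

/-- Contents of the registers and of the arrays. -/
structure State : Type where
  reg : ℕ → ℕ
  arr : ℕ → ℕ → ℕ

namespace State

def setReg (s : State) (x v : ℕ) : State :=
  { s with reg := Function.update s.reg x v }

def setArr (s : State) (a i v : ℕ) : State :=
  { s with arr := Function.update s.arr a (Function.update (s.arr a) i v) }

end State

namespace Expr

/-- The value of an expression; subtraction is truncated at `0` and comparisons have the value
`1` (true) or `0` (false). -/
def eval (s : State) : Expr → ℕ
  | const k => k
  | reg x => s.reg x
  | get a i => s.arr a (i.eval s)
  | add e₁ e₂ => e₁.eval s + e₂.eval s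
  | sub e₁ e₂ => e₁.eval s - e₂.eval s
  | lt e₁ e₂ => if e₁.eval s < e₂.eval s then 1 else 0
  | eq e₁ e₂ => if e₁.eval s = e₂.eval s then 1 else 0

/-- Time to evaluate an expression: one unit for each operation in it. -/
def cost : Expr → ℕ
  | const _ => 1
  | reg _ => 1
  | get _ i => i.cost + 1
  | add e₁ e₂ => e₁.cost + e₂.cost + 1
  | sub e₁ e₂ => e₁.cost + e₂.cost + 1
  | lt e₁ e₂ => e₁.cost + e₂.cost + 1
  | eq e₁ e₂ => e₁.cost + e₂.cost + 1

/-- All numbers that come up in the evaluation of an expression (constants, array indices,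
intermediate results, the value itself) are at most `W`. -/
def Fits (W : ℕ) (s : State) : Expr → Prop
  | const k => k ≤ W
  | reg x => s.reg x ≤ W
  | get a i => i.Fits W s ∧ s.arr a (i.eval s) ≤ W
  | add e₁ e₂ => e₁.Fits W s ∧ e₂.Fits W s ∧ e₁.eval s + e₂.eval s ≤ W
  | sub e₁ e₂ => e₁.Fits W s ∧ e₂.Fits W s
  | lt e₁ e₂ => e₁.Fits W s ∧ e₂.Fits W s ∧ 1 ≤ W
  | eq e₁ e₂ => e₁.Fits W s ∧ e₂.Fits W s ∧ 1 ≤ W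

end Expr

/-- `Exec W p s t s'`: started in the state `s`, the program `p` halts after exactly `t` units of
time in the state `s'`, and no number larger than `W` comes up during the run. -/
inductive Exec (W : ℕ) : Prog → State → ℕ → State → Prop
  | skip (s : State) : Exec W .skip s 1 s
  | assign (s : State) (x : ℕ) (e : Expr) (he : e.Fits W s) :
      Exec W (.assign x e) s (e.cost + 1) (s.setReg x (e.eval s))
  | store (s : State) (a : ℕ) (i e : Expr) (hi : i.Fits W s) (he : e.Fits W s) :
      Exec W (.store a i e) s (i.cost + e.cost + 1) (s.setArr a (i.eval s) (e.eval s))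
  | seq {p q : Prog} {s s₁ s₂ : State} {t₁ t₂ : ℕ}
      (hp : Exec W p s t₁ s₁) (hq : Exec W q s₁ t₂ s₂) :
      Exec W (.seq p q) s (t₁ + t₂) s₂
  | ite_true {e : Expr} {p q : Prog} {s s' : State} {t : ℕ}
      (he : e.Fits W s) (hne : e.eval s ≠ 0) (hp : Exec W p s t s') :
      Exec W (.ite e p q) s (e.cost + 1 + t) s'
  | ite_false {e : Expr} {p q : Prog} {s s' : State} {t : ℕ}
      (he : e.Fits W s) (hz : e.eval s = 0) (hq : Exec W q s t s') :
      Exec W (.ite e p q) s (e.cost + 1 + t) s'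
  | loop_true {e : Expr} {p : Prog} {s s₁ s₂ : State} {t₁ t₂ : ℕ}
      (he : e.Fits W s) (hne : e.eval s ≠ 0)
      (hp : Exec W p s t₁ s₁) (hl : Exec W (.loop e p) s₁ t₂ s₂) :
      Exec W (.loop e p) s (e.cost + 1 + t₁ + t₂) s₂
  | loop_false {e : Expr} {p : Prog} {s : State}
      (he : e.Fits W s) (hz : e.eval s = 0) :
      Exec W (.loop e p) s (e.cost + 1) s

/-! ### Input and output -/

/-- `nbrs` is an adjacency list of `G`: for each vertex, a list of its neighbours without
repetitions, in any order. -/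
def IsAdjacencyList {n : ℕ} (G : SimpleGraph (Fin n)) (nbrs : Fin n → List (Fin n)) : Prop :=
  ∀ v, (nbrs v).Nodup ∧ ∀ w, w ∈ nbrs v ↔ G.Adj v w

/-- The initial state for the adjacency list `nbrs`.  Register `0` holds the number `n` of
vertices.  Array `1` is the concatenation of the lists of neighbours of the vertices
`0, 1, …, n - 1`, and for `k ≤ n` cell `k` of array `0` is the total length of the lists of the
vertices smaller than `k`; thus the neighbours of the vertex `v` are in the cells of array `1`
from the index in cell `v` up to, and not including, the index in cell `v + 1` of array `0`.
Everything else is `0`. -/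
def inputState {n : ℕ} (nbrs : Fin n → List (Fin n)) : State where
  reg x := if x = 0 then n else 0
  arr a k :=
    if a = 0 then
      if k ≤ n then ((List.ofFn nbrs).take k).flatten.length else 0
    else if a = 1 then
      ((List.ofFn nbrs).flatten.map Fin.val).getD k 0
    else 0

/-- In the state `s` the output is a list, without repetitions, of all edges in the set `E`:
register `1` holds the number of edges in the list, and cell `i` of array `2` and cell `i` of
array `3` are the two ends of the edge at position `i`. -/
def Outputs {n : ℕ} (s : State) (E : Set (Sym2 (Fin n))) : Prop :=
  ∃ L : List (Fin n × Fin n),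
    (L.map fun p => s(p.1, p.2)).Nodup ∧
    (∀ e, e ∈ E ↔ e ∈ L.map fun p => s(p.1, p.2)) ∧
    s.reg 1 = L.length ∧
    ∀ (i : ℕ) (hi : i < L.length),
      s.arr 2 i = (L[i].1 : ℕ) ∧ s.arr 3 i = (L[i].2 : ℕ)

end RAM

/-!
A proper interval graph has an *umbrella ordering*: its vertices can be arranged on a line in such a
way that every closed neighbourhood is an interval.  In such an ordering, a matching is uniquely
restricted if and only if its edges, written `(u, v)` with the left end first, lie one after the
other, and no two of them, `(u, v)` and `(x, y)`, have both `u` adjacent to `x` and `v` adjacent to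
`y` (`SimpleGraph.IsLayout.isUniquelyRestricted_iff`).  If this fails, exchanging the partners of
the two edges gives another matching; if it holds, any matching of the same vertices is forced from
left to right.  If `L` is the first position in the closed neighbourhood, the condition says that
`u < L x` or `v < L y`, so a largest such sequence of edges is found by a dynamic program over the
positions whose two tables bound the left end and the right end of the last edge (`IsTable`,
`IsTable.card_filter_le`).

An umbrella ordering is found by two breadth-first searches.  The first one visits the vertices
discovered from the same vertex by descending degree, and then the last vertex it visits in a
component has the same closed neighbourhood as one of the two extreme vertices of the component
(`SimpleGraph.IsSearchOrder.exists_isUmbrella_le_of_last`).  The second one starts at these vertices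
and visits siblings by ascending degree; vertices discovered from the same vertex then have the same
first neighbour, so their degrees tell the order of their last neighbours, and the search order is
an umbrella ordering (`SimpleGraph.IsSearchOrder.isUmbrella_pos`).

On the machine, the adjacency lists are sorted by degree by distributing the edges over buckets and
from there over linked lists.  Every loop has an invariant and a bound for the number of its rounds
that is linear in the size of the input (`RAM.exists_reaches_loop`).  All additions in the programs
are additions of `1`, so no number exceeds the largest number in the input by more than the running
time (`RAM.Exec.of_slow`), and the bound for the word size follows from the one for the time.
-/

namespace RAM

/-! ### Running programs -/

/-- The value in every register and every array cell is at most `M`. -/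
def State.BoundedBy (s : State) (M : ℕ) : Prop :=
  (∀ x, s.reg x ≤ M) ∧ ∀ a i, s.arr a i ≤ M

/-- Constants are `0` or `1` and one operand of every addition is a constant, so that evaluating
the expression exceeds the contents of the memory by no more than the time it takes. -/
def Expr.Slow : Expr → Prop
  | .const k => k ≤ 1
  | .reg _ => True
  | .get _ i => i.Slow
  | .add e₁ e₂ => e₁.Slow ∧ e₂ = .const 1
  | .sub e₁ e₂ => e₁.Slow ∧ e₂.Slow
  | .lt e₁ e₂ => e₁.Slow ∧ e₂.Slow
  | .eq e₁ e₂ => e₁.Slow ∧ e₂.Slow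

/-- All expressions of the program are slow. -/
def Prog.Slow : Prog → Prop
  | .skip => True
  | .assign _ e => e.Slow
  | .store _ i e => i.Slow ∧ e.Slow
  | .seq p q => p.Slow ∧ q.Slow
  | .ite e p q => e.Slow ∧ p.Slow ∧ q.Slow
  | .loop e p => e.Slow ∧ p.Slow

namespace Expr

theorem Fits.mono {W W' : ℕ} (hW : W ≤ W') {s : State} {e : Expr} (h : e.Fits W s) :
    e.Fits W' s := by
  induction e with
  | const k => exact le_trans h hW
  | reg x => exact le_trans h hW
  | get a i ih => exact ⟨ih h.1, h.2.trans hW⟩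
  | add e₁ e₂ ih₁ ih₂ => exact ⟨ih₁ h.1, ih₂ h.2.1, h.2.2.trans hW⟩
  | sub e₁ e₂ ih₁ ih₂ => exact ⟨ih₁ h.1, ih₂ h.2⟩
  | lt e₁ e₂ ih₁ ih₂ => exact ⟨ih₁ h.1, ih₂ h.2.1, h.2.2.trans hW⟩
  | eq e₁ e₂ ih₁ ih₂ => exact ⟨ih₁ h.1, ih₂ h.2.1, h.2.2.trans hW⟩

theorem exists_fits (s : State) (e : Expr) : ∃ W, e.Fits W s := by
  induction e with
  | const k => exact ⟨k, le_rfl⟩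
  | reg x => exact ⟨s.reg x, le_rfl⟩
  | get a i ih =>
    obtain ⟨W, h⟩ := ih
    exact ⟨max W (s.arr a (i.eval s)), h.mono (le_max_left _ _), le_max_right _ _⟩
  | add e₁ e₂ ih₁ ih₂ =>
    obtain ⟨W₁, h₁⟩ := ih₁
    obtain ⟨W₂, h₂⟩ := ih₂
    exact ⟨W₁ + W₂ + (e₁.eval s + e₂.eval s), h₁.mono (by omega), h₂.mono (by omega), by omega⟩
  | sub e₁ e₂ ih₁ ih₂ =>
    obtain ⟨W₁, h₁⟩ := ih₁
    obtain ⟨W₂, h₂⟩ := ih₂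
    exact ⟨W₁ + W₂, h₁.mono (by omega), h₂.mono (by omega)⟩
  | lt e₁ e₂ ih₁ ih₂ =>
    obtain ⟨W₁, h₁⟩ := ih₁
    obtain ⟨W₂, h₂⟩ := ih₂
    exact ⟨W₁ + W₂ + 1, h₁.mono (by omega), h₂.mono (by omega), by omega⟩
  | eq e₁ e₂ ih₁ ih₂ =>
    obtain ⟨W₁, h₁⟩ := ih₁
    obtain ⟨W₂, h₂⟩ := ih₂
    exact ⟨W₁ + W₂ + 1, h₁.mono (by omega), h₂.mono (by omega), by omega⟩

theorem Slow.fits_and_eval_le {s : State} {M : ℕ} (hs : s.BoundedBy M) {e : Expr} (he : e.Slow) :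
    e.Fits (M + e.cost) s ∧ e.eval s ≤ M + e.cost := by
  induction e with
  | const k => simp only [Slow] at he; simp only [Fits, eval, cost]; omega
  | reg x => have := hs.1 x; simp only [Fits, eval, cost]; omega
  | get a i ih =>
    have := hs.2 a (i.eval s)
    exact ⟨⟨(ih he).1.mono (by simp only [cost]; omega), by omega⟩, by simp only [eval]; omega⟩
  | add e₁ e₂ ih₁ _ =>
    obtain ⟨h₁, rfl⟩ := he
    have := (ih₁ h₁).2
    refine ⟨⟨(ih₁ h₁).1.mono (by simp only [cost]; omega), ?_, ?_⟩, ?_⟩ <;>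
      simp only [Fits, eval, cost] <;> omega
  | sub e₁ e₂ ih₁ ih₂ =>
    have := (ih₁ he.1).2
    refine ⟨⟨(ih₁ he.1).1.mono ?_, (ih₂ he.2).1.mono ?_⟩, ?_⟩ <;>
      simp only [eval, cost] <;> omega
  | lt e₁ e₂ ih₁ ih₂ =>
    refine ⟨⟨(ih₁ he.1).1.mono ?_, (ih₂ he.2).1.mono ?_, ?_⟩, ?_⟩ <;>
      simp only [eval, cost] <;> first | omega | (split_ifs <;> omega)
  | eq e₁ e₂ ih₁ ih₂ =>
    refine ⟨⟨(ih₁ he.1).1.mono ?_, (ih₂ he.2).1.mono ?_, ?_⟩, ?_⟩ <;>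
      simp only [eval, cost] <;> first | omega | (split_ifs <;> omega)

end Expr

theorem State.BoundedBy.mono {s : State} {M M' : ℕ} (h : s.BoundedBy M) (hM : M ≤ M') :
    s.BoundedBy M' :=
  ⟨fun x => (h.1 x).trans hM, fun a i => (h.2 a i).trans hM⟩

theorem State.BoundedBy.setReg {s : State} {M v : ℕ} (h : s.BoundedBy M) (hv : v ≤ M) (x : ℕ) :
    (s.setReg x v).BoundedBy M := by
  refine ⟨fun y => ?_, h.2⟩
  simp only [State.setReg, Function.update_apply]
  split_ifs
  exacts [hv, h.1 y]

theorem State.BoundedBy.setArr {s : State} {M v : ℕ} (h : s.BoundedBy M) (hv : v ≤ M) (a i : ℕ) :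
    (s.setArr a i v).BoundedBy M := by
  refine ⟨h.1, fun b j => ?_⟩
  simp only [State.setArr, Function.update_apply]
  split_ifs
  · simp only [Function.update_apply]
    split_ifs
    exacts [hv, h.2 a j]
  · exact h.2 b j

theorem Exec.mono {W W' : ℕ} (hW : W ≤ W') {p : Prog} {s s' : State} {t : ℕ}
    (h : Exec W p s t s') : Exec W' p s t s' := by
  induction h with
  | skip s => exact .skip s
  | assign s x e he => exact .assign s x e (he.mono hW)
  | store s a i e hi he => exact .store s a i e (hi.mono hW) (he.mono hW)
  | seq _ _ ihp ihq => exact .seq ihp ihq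
  | ite_true he hne _ ih => exact .ite_true (he.mono hW) hne ih
  | ite_false he hz _ ih => exact .ite_false (he.mono hW) hz ih
  | loop_true he hne _ _ ihp ihl => exact .loop_true (he.mono hW) hne ihp ihl
  | loop_false he hz => exact .loop_false (he.mono hW) hz

/-- A slow program that halts after time `t` meets no number that exceeds the initial contents of
the memory by more than `t`.  This settles the word size of all programs below at once. -/
theorem Exec.of_slow {W : ℕ} {p : Prog} {s s' : State} {t : ℕ} (h : Exec W p s t s')
    (hp : p.Slow) {M : ℕ} (hs : s.BoundedBy M) :
    Exec (M + t) p s t s' ∧ s'.BoundedBy (M + t) := by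
  induction h generalizing M with
  | skip s => exact ⟨.skip s, hs.mono (by omega)⟩
  | assign s x e he =>
    obtain ⟨h₁, h₂⟩ := Expr.Slow.fits_and_eval_le hs hp
    exact ⟨.assign s x e (h₁.mono (by omega)), (hs.mono (by omega)).setReg (by omega) x⟩
  | store s a i e hi he =>
    obtain ⟨h₁, _⟩ := Expr.Slow.fits_and_eval_le hs hp.1
    obtain ⟨h₃, h₄⟩ := Expr.Slow.fits_and_eval_le hs hp.2
    exact ⟨.store s a i e (h₁.mono (by omega)) (h₃.mono (by omega)),
      (hs.mono (by omega)).setArr (by omega) a _⟩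
  | @seq p q s s₁ s₂ t₁ t₂ _ _ ihp ihq =>
    obtain ⟨h₁, h₂⟩ := ihp hp.1 hs
    obtain ⟨h₃, h₄⟩ := ihq hp.2 h₂
    exact ⟨.seq (h₁.mono (by omega)) (h₃.mono (by omega)), h₄.mono (by omega)⟩
  | ite_true he hne _ ih =>
    obtain ⟨h₁, _⟩ := Expr.Slow.fits_and_eval_le hs hp.1
    obtain ⟨h₃, h₄⟩ := ih hp.2.1 hs
    exact ⟨.ite_true (h₁.mono (by omega)) hne (h₃.mono (by omega)), h₄.mono (by omega)⟩
  | ite_false he hz _ ih =>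
    obtain ⟨h₁, _⟩ := Expr.Slow.fits_and_eval_le hs hp.1
    obtain ⟨h₃, h₄⟩ := ih hp.2.2 hs
    exact ⟨.ite_false (h₁.mono (by omega)) hz (h₃.mono (by omega)), h₄.mono (by omega)⟩
  | loop_true he hne _ _ ihp ihl =>
    obtain ⟨h₁, _⟩ := Expr.Slow.fits_and_eval_le hs hp.1
    obtain ⟨h₃, h₄⟩ := ihp hp.2 hs
    obtain ⟨h₅, h₆⟩ := ihl hp h₄
    exact ⟨.loop_true (h₁.mono (by omega)) hne (h₃.mono (by omega)) (h₅.mono (by omega)),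
      h₆.mono (by omega)⟩
  | loop_false he hz =>
    obtain ⟨h₁, _⟩ := Expr.Slow.fits_and_eval_le hs hp.1
    exact ⟨.loop_false (h₁.mono (by omega)) hz, hs.mono (by omega)⟩

/-- The program writes into the register `x`. -/
def Prog.SetsReg (x : ℕ) : Prog → Prop
  | .skip => False
  | .assign y _ => x = y
  | .store _ _ _ => False
  | .seq p q => p.SetsReg x ∨ q.SetsReg x
  | .ite _ p q => p.SetsReg x ∨ q.SetsReg x
  | .loop _ p => p.SetsReg x

/-- The program writes into the array `a`. -/
def Prog.SetsArr (a : ℕ) : Prog → Prop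
  | .skip => False
  | .assign _ _ => False
  | .store b _ _ => a = b
  | .seq p q => p.SetsArr a ∨ q.SetsArr a
  | .ite _ p q => p.SetsArr a ∨ q.SetsArr a
  | .loop _ p => p.SetsArr a

theorem Exec.reg_eq {W : ℕ} {p : Prog} {s s' : State} {t : ℕ} (h : Exec W p s t s') {x : ℕ}
    (hx : ¬ p.SetsReg x) : s'.reg x = s.reg x := by
  induction h with
  | skip s => rfl
  | assign s y e he => exact Function.update_of_ne hx _ _
  | store s a i e hi he => rfl
  | seq _ _ ihp ihq =>
    simp only [Prog.SetsReg, not_or] at hx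
    rw [ihq hx.2, ihp hx.1]
  | ite_true he hne _ ih => exact ih fun h => hx (Or.inl h)
  | ite_false he hz _ ih => exact ih fun h => hx (Or.inr h)
  | loop_true he hne _ _ ihp ihl => rw [ihl hx, ihp hx]
  | loop_false he hz => rfl

theorem Exec.arr_eq {W : ℕ} {p : Prog} {s s' : State} {t : ℕ} (h : Exec W p s t s') {a : ℕ}
    (ha : ¬ p.SetsArr a) : s'.arr a = s.arr a := by
  induction h with
  | skip s => rfl
  | assign s y e he => rfl
  | store s b i e hi he => exact Function.update_of_ne ha _ _
  | seq _ _ ihp ihq =>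
    simp only [Prog.SetsArr, not_or] at ha
    rw [ihq ha.2, ihp ha.1]
  | ite_true he hne _ ih => exact ih fun h => ha (Or.inl h)
  | ite_false he hz _ ih => exact ih fun h => ha (Or.inr h)
  | loop_true he hne _ _ ihp ihl => rw [ihl ha, ihp ha]
  | loop_false he hz => rfl

/-- Started in the state `s`, the program `p` halts within time `T` in the state `s'`; the word
size is left open. -/
def Reaches (p : Prog) (s : State) (T : ℕ) (s' : State) : Prop :=
  ∃ t ≤ T, ∃ W, Exec W p s t s'

theorem Reaches.seq {p q : Prog} {s s₁ s₂ : State} {T₁ T₂ : ℕ} (hp : Reaches p s T₁ s₁)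
    (hq : Reaches q s₁ T₂ s₂) : Reaches (.seq p q) s (T₁ + T₂) s₂ := by
  obtain ⟨t₁, h₁, W₁, hp⟩ := hp
  obtain ⟨t₂, h₂, W₂, hq⟩ := hq
  exact ⟨t₁ + t₂, by omega, max W₁ W₂,
    .seq (hp.mono (le_max_left _ _)) (hq.mono (le_max_right _ _))⟩

theorem Reaches.mono {p : Prog} {s s' : State} {T T' : ℕ} (h : Reaches p s T s') (hT : T ≤ T') :
    Reaches p s T' s' :=
  let ⟨t, ht, h⟩ := h
  ⟨t, ht.trans hT, h⟩

theorem Reaches.reg_eq {p : Prog} {s s' : State} {T : ℕ} (h : Reaches p s T s') {x : ℕ}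
    (hx : ¬ p.SetsReg x) : s'.reg x = s.reg x :=
  let ⟨_, _, _, h⟩ := h
  h.reg_eq hx

theorem Reaches.arr_eq {p : Prog} {s s' : State} {T : ℕ} (h : Reaches p s T s') {a : ℕ}
    (ha : ¬ p.SetsArr a) : s'.arr a = s.arr a :=
  let ⟨_, _, _, h⟩ := h
  h.arr_eq ha

namespace Prog

/-- The program has no loops. -/
def LoopFree : Prog → Prop
  | .skip | .assign _ _ | .store _ _ _ => True
  | .seq p q | .ite _ p q => p.LoopFree ∧ q.LoopFree
  | .loop _ _ => False

/-- The state in which a loop-free program halts (loops are ignored). -/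
def final : Prog → State → State
  | .skip, s => s
  | .assign x e, s => s.setReg x (e.eval s)
  | .store a i e, s => s.setArr a (i.eval s) (e.eval s)
  | .seq p q, s => q.final (p.final s)
  | .ite e p q, s => if e.eval s = 0 then q.final s else p.final s
  | .loop _ _, s => s

/-- A bound for the running time of a loop-free program (loops are ignored). -/
def maxTime : Prog → ℕ
  | .skip => 1
  | .assign _ e => e.cost + 1
  | .store _ i e => i.cost + e.cost + 1
  | .seq p q => p.maxTime + q.maxTime
  | .ite e p q => e.cost + 1 + (p.maxTime + q.maxTime)
  | .loop _ _ => 0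

theorem LoopFree.reaches {p : Prog} (hp : p.LoopFree) (s : State) :
    Reaches p s p.maxTime (p.final s) := by
  induction p generalizing s with
  | skip => exact ⟨1, le_rfl, 0, .skip s⟩
  | assign x e =>
    obtain ⟨W, h⟩ := e.exists_fits s
    exact ⟨_, le_rfl, W, .assign s x e h⟩
  | store a i e =>
    obtain ⟨W, h⟩ := e.exists_fits s
    obtain ⟨W', h'⟩ := i.exists_fits s
    exact ⟨_, le_rfl, max W W', .store s a i e (h'.mono (le_max_right _ _))
      (h.mono (le_max_left _ _))⟩
  | seq p q ihp ihq => exact (ihp hp.1 s).seq (ihq hp.2 _)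
  | ite e p q ihp ihq =>
    obtain ⟨W, h⟩ := e.exists_fits s
    simp only [final, maxTime]
    split_ifs with he
    · obtain ⟨t, ht, W', h'⟩ := ihq hp.2 s
      exact ⟨e.cost + 1 + t, by omega, max W W', .ite_false (h.mono (le_max_left _ _)) he
        (h'.mono (le_max_right _ _))⟩
    · obtain ⟨t, ht, W', h'⟩ := ihp hp.1 s
      exact ⟨e.cost + 1 + t, by omega, max W W', .ite_true (h.mono (le_max_left _ _)) he
        (h'.mono (le_max_right _ _))⟩
  | loop e p => exact hp.elim

end Prog

/-- The rule for loops: `I` is an invariant of the loop and `μ` bounds the number of rounds that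
are still to come. -/
theorem exists_reaches_loop {e : Expr} {p : Prog} (hp : p.LoopFree) (I : State → Prop)
    (μ : State → ℕ)
    (hstep : ∀ s, I s → e.eval s ≠ 0 → I (p.final s) ∧ μ (p.final s) < μ s)
    (s : State) (hs : I s) :
    ∃ s', Reaches (.loop e p) s ((μ s + 1) * (e.cost + 1 + p.maxTime)) s' ∧
      I s' ∧ e.eval s' = 0 := by
  induction h : μ s using Nat.strong_induction_on generalizing s with
  | _ m ih =>
    obtain ⟨W, hW⟩ := e.exists_fits s
    by_cases he : e.eval s = 0
    · refine ⟨s, ⟨e.cost + 1, ?_, W, .loop_false hW he⟩, hs, he⟩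
      calc e.cost + 1 ≤ 1 * (e.cost + 1 + p.maxTime) := by omega
        _ ≤ _ := Nat.mul_le_mul_right _ (by omega)
    · obtain ⟨hI, hμ⟩ := hstep s hs he
      obtain ⟨s', ⟨t₂, ht₂, W₂, h₂⟩, hI', he'⟩ := ih _ (h ▸ hμ) _ hI rfl
      obtain ⟨t₁, ht₁, W₁, h₁⟩ := hp.reaches s
      refine ⟨s', ⟨e.cost + 1 + t₁ + t₂, ?_, W + W₁ + W₂,
        .loop_true (hW.mono (by omega)) he (h₁.mono (by omega)) (h₂.mono (by omega))⟩, hI', he'⟩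
      have : (μ (p.final s) + 1 + 1) * (e.cost + 1 + p.maxTime) ≤
          (m + 1) * (e.cost + 1 + p.maxTime) := Nat.mul_le_mul_right _ (by omega)
      have h3 : (μ (p.final s) + 1 + 1) * (e.cost + 1 + p.maxTime) =
        (μ (p.final s) + 1) * (e.cost + 1 + p.maxTime) + (e.cost + 1 + p.maxTime) := by ring
      omega

end RAM

namespace SimpleGraph

variable {V : Type*}

/-! ### Umbrella orderings -/

/-- `x` and `y` are equal or adjacent. -/
def ClosedAdj (G : SimpleGraph V) (x y : V) : Prop := x = y ∨ G.Adj x y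

/-- `f` arranges the vertices on a line, possibly with ties, in such a way that the closed
neighbourhoods are intervals: if `x` and `z` are adjacent, everything between them is adjacent to
both.  Since `x = z` is allowed, vertices with the same value are adjacent. -/
def IsUmbrella (G : SimpleGraph V) (f : V → ℝ) : Prop :=
  ∀ x y z, f x ≤ f y → f y ≤ f z → G.ClosedAdj x z → G.ClosedAdj x y ∧ G.ClosedAdj y z

variable {G : SimpleGraph V}

theorem ClosedAdj.refl (x : V) : G.ClosedAdj x x := Or.inl rfl

theorem ClosedAdj.symm {x y : V} (h : G.ClosedAdj x y) : G.ClosedAdj y x :=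
  h.imp Eq.symm fun h => h.symm

theorem ClosedAdj.reachable {x y : V} (h : G.ClosedAdj x y) : G.Reachable x y := by
  rcases h with rfl | h
  exacts [Reachable.refl _, h.reachable]

theorem IsUmbrella.neg {f : V → ℝ} (hf : G.IsUmbrella f) : G.IsUmbrella fun x => -f x := by
  intro x y z hxy hyz h
  obtain ⟨h₁, h₂⟩ := hf z y x (neg_le_neg_iff.1 hyz) (neg_le_neg_iff.1 hxy) h.symm
  exact ⟨h₂.symm, h₁.symm⟩

/-- The left ends of the intervals of a proper interval representation, which are in the same
order as the right ends, form an umbrella ordering. -/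
theorem IsProperInterval.exists_isUmbrella (hG : G.IsProperInterval) :
    ∃ f : V → ℝ, G.IsUmbrella f := by
  obtain ⟨l, r, hlr, hadj, hproper⟩ := hG
  have hr : ∀ x y, l x ≤ l y → r x ≤ r y := by
    intro x y hxy
    by_contra! h
    refine hproper y x ⟨Set.Icc_subset_Icc hxy h.le, fun hs => ?_⟩
    exact absurd (hs ⟨hlr x, le_rfl⟩).2 (not_le.2 h)
  have hmeet : ∀ x y, l x ≤ l y → l y ≤ r x → G.ClosedAdj x y := by
    intro x y hxy hyx
    by_cases h : x = y
    · exact Or.inl h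
    · exact Or.inr ((hadj x y h).2 ⟨l y, ⟨hxy, hyx⟩, le_rfl, hlr y⟩)
  refine ⟨l, fun x y z hxy hyz h => ?_⟩
  have hzx : l z ≤ r x := by
    rcases h with rfl | h
    · exact hlr x
    · obtain ⟨t, ht⟩ := (hadj x z h.ne).1 h
      exact ht.2.1.trans ht.1.2
  exact ⟨hmeet x y hxy (hyz.trans hzx), hmeet y z hyz (hzx.trans (hr x y hxy))⟩

/-- If the closed neighbourhood of `x` is contained in that of `z` and the degree of `z` is no
larger, the two closed neighbourhoods agree. -/
theorem closedAdj_of_ncard_le [Finite V] {x z : V} (h : ∀ y, G.ClosedAdj x y → G.ClosedAdj z y)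
    (hd : (G.neighborSet z).ncard ≤ (G.neighborSet x).ncard) (y : V) (hy : G.ClosedAdj z y) :
    G.ClosedAdj x y := by
  have hset : ∀ v, {y | G.ClosedAdj v y} = insert v (G.neighborSet v) := by
    intro v
    ext y
    simp [ClosedAdj, eq_comm]
  have hcard : ∀ v, {y | G.ClosedAdj v y}.ncard = (G.neighborSet v).ncard + 1 := by
    intro v
    rw [hset, Set.ncard_insert_of_notMem (by simp)]
  have := Set.eq_of_subset_of_ncard_le (s := {y | G.ClosedAdj x y}) (t := {y | G.ClosedAdj z y}) h
    (by rw [hcard, hcard]; omega)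
  exact this.ge hy

/-! ### Breadth-first search in a proper interval graph -/

/-- The vertices are arranged by a breadth-first search: `pos v` is the position of `v`, and
`par v` is the earliest vertex of the closed neighbourhood of `v`, so `v` is the root of its
component if `par v = v`, and has been discovered from `par v` otherwise.  Vertices discovered
from the same vertex are visited by descending values of `key`. -/
structure IsSearchOrder (G : SimpleGraph V) (pos : V → ℕ) (par : V → V) (key : V → ℕ) :
    Prop where
  inj : Function.Injective pos
  closedAdj_par : ∀ x, G.ClosedAdj (par x) x
  pos_par_le : ∀ x y, G.ClosedAdj y x → pos (par x) ≤ pos y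
  mono : ∀ x y, pos x ≤ pos y → pos (par x) ≤ pos (par y)
  siblings : ∀ x y, pos x < pos y → par x = par y → par x ≠ x → key y ≤ key x

namespace IsSearchOrder

variable {pos : V → ℕ} {par : V → V} {key : V → ℕ}

theorem pos_par_lt (h : G.IsSearchOrder pos par key) {x : V} (hx : par x ≠ x) :
    pos (par x) < pos x :=
  lt_of_le_of_ne (h.pos_par_le x x (.refl x)) fun h' => hx (h.inj h')

/-- A root is the first vertex of its component. -/
theorem pos_root_le (h : G.IsSearchOrder pos par key) {s y : V} (hs : par s = s)
    (hy : G.Reachable s y) : pos s ≤ pos y := by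
  rw [reachable_iff_reflTransGen] at hy
  induction hy with
  | refl => exact le_rfl
  | @tail y z _ hyz ih =>
    by_contra! hlt
    have h₁ := h.mono s y ih
    have h₂ := h.pos_par_le y z (Or.inr hyz.symm)
    rw [hs] at h₁
    omega

theorem eq_root (h : G.IsSearchOrder pos par key) {s y : V} (hs : par s = s) (hy : par y = y)
    (hsy : G.Reachable s y) : y = s :=
  h.inj (le_antisymm (h.pos_root_le hy hsy.symm) (h.pos_root_le hs hsy))

theorem exists_root (h : G.IsSearchOrder pos par key) (x : V) :
    ∃ s, par s = s ∧ G.Reachable s x := by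
  induction hn : pos x using Nat.strong_induction_on generalizing x with
  | _ n ih =>
    by_cases hx : par x = x
    · exact ⟨x, hx, .refl x⟩
    · obtain ⟨s, hs, hsx⟩ := ih _ (hn ▸ h.pos_par_lt hx) (par x) rfl
      exact ⟨s, hs, hsx.trans (h.closedAdj_par x).reachable⟩

/-- The search order visits the components one after the other. -/
theorem reachable_of_lt_of_lt (h : G.IsSearchOrder pos par key) {x y z : V} (hxy : pos x < pos y)
    (hyz : pos y < pos z) (hxz : G.ClosedAdj x z) : G.Reachable x y := by
  obtain ⟨s, hs, hsx⟩ := h.exists_root x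
  obtain ⟨t, ht, hty⟩ := h.exists_root y
  have h₁ := h.pos_root_le hs hsx
  have h₂ : pos t ≤ pos x := by
    by_contra! hlt
    have h₃ := h.mono t y (h.pos_root_le ht hty)
    have h₄ := h.mono y z hyz.le
    have h₅ := h.pos_par_le z x hxz
    rw [ht] at h₃
    omega
  -- No vertex before a root is reachable from a vertex after it.
  have key : ∀ {s t : V}, par t = t → pos s < pos t → ∀ u, G.Reachable s u → pos u < pos t := by
    intro s t ht hst u hu
    rw [reachable_iff_reflTransGen] at hu
    induction hu with
    | refl => exact hst
    | @tail y z _ hyz ih =>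
      by_contra! hlt
      have h₁ := h.mono t z hlt
      have h₂ := h.pos_par_le z y (Or.inr hyz)
      rw [ht] at h₁
      omega
  rcases lt_trichotomy (pos s) (pos t) with hst | hst | hst
  · have := key ht hst x hsx
    omega
  · obtain rfl := h.inj hst
    exact hsx.symm.trans hty
  · have := key hs hst y hty
    omega

/-- A search whose root lies to the right of `z` discovers a neighbour of `z` before it gets past
`z` to a vertex `x` on the left: the first ancestor of `x` that is not to the left of `z` is
adjacent to `z`, because its child is to the left of `z`. -/
theorem exists_closedAdj_pos_le (h : G.IsSearchOrder pos par key) {f : V → ℝ}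
    (hf : G.IsUmbrella f) {s z : V} (hs : par s = s) (hzs : f z ≤ f s) (x : V)
    (hsx : G.Reachable s x) (hxz : f x < f z) :
    ∃ w, G.ClosedAdj w z ∧ pos w ≤ pos (par x) ∧ (¬ G.ClosedAdj x z → pos w < pos (par x)) := by
  induction hn : pos x using Nat.strong_induction_on generalizing x with
  | _ n ih =>
    have hx : par x ≠ x := by
      intro hx
      rw [h.eq_root hs hx hsx] at hxz
      exact absurd hzs (not_le.2 hxz)
    have hadj := h.closedAdj_par x
    by_cases hP : f z ≤ f (par x)
    · obtain ⟨h₁, h₂⟩ := hf x z (par x) hxz.le hP hadj.symm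
      exact ⟨par x, h₂.symm, le_rfl, fun h => absurd h₁ h⟩
    · have hlt := h.pos_par_lt hx
      obtain ⟨w, hw, hw', -⟩ := ih _ (hn ▸ hlt) (par x)
        (hsx.trans hadj.symm.reachable) (not_le.1 hP) rfl
      have : pos w < pos (par x) := by
        by_cases hr : par (par x) = par x
        · have heq := h.eq_root hs hr (hsx.trans hadj.symm.reachable)
          rw [heq] at hP
          exact absurd hzs hP
        · have := h.pos_par_lt hr
          omega
      exact ⟨w, hw, this.le, fun _ => this⟩

/-- The vertex that a breadth-first search visits last in a component lies at an end of the
component, if siblings are visited by descending degree. -/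
theorem exists_isUmbrella_le_of_last [Finite V] (h : G.IsSearchOrder pos par key)
    (hkey : ∀ x y, key y ≤ key x → (G.neighborSet y).ncard ≤ (G.neighborSet x).ncard)
    {f : V → ℝ} (hf : G.IsUmbrella f) {z : V} (hz : ∀ y, G.Reachable z y → pos y ≤ pos z) :
    ∃ g : V → ℝ, G.IsUmbrella g ∧ ∀ y, G.Reachable z y → g z ≤ g y := by
  classical
  obtain ⟨s, hs, hsz⟩ := h.exists_root z
  wlog hzs : f z ≤ f s generalizing f
  · exact this hf.neg (neg_le_neg (not_le.1 hzs).le)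
  obtain ⟨m, hm, hmin⟩ := Set.exists_min_image {y | G.Reachable z y} f (Set.toFinite _)
    ⟨z, Reachable.refl z⟩
  simp only [Set.mem_ofPred_eq] at hm hmin
  -- The vertex `z` and the leftmost vertex `m` of its component have the same closed neighbourhood.
  have htwin : ∀ y, G.ClosedAdj m y ↔ G.ClosedAdj z y := by
    rcases (hmin z (.refl z)).eq_or_lt with heq | hlt
    · intro y
      have key : ∀ a b, f a = f b → G.ClosedAdj a y → G.ClosedAdj b y := by
        intro a b hab hay
        rcases le_total (f b) (f y) with hby | hby
        · exact (hf a b y hab.le hby hay).2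
        · exact (hf y b a hby hab.ge hay.symm).1.symm
      exact ⟨key m z heq, key z m heq.symm⟩
    · have hsm := hsz.trans hm
      have hmr : par m ≠ m := by
        intro hr
        rw [h.eq_root hs hr hsm] at hlt
        exact absurd hzs (not_le.2 hlt)
      have hne : m ≠ z := by
        rintro rfl
        exact lt_irrefl _ hlt
      have hpos : pos m < pos z := lt_of_le_of_ne (hz m hm) fun h' => hne (h.inj h')
      have hpar := h.mono m z hpos.le
      obtain ⟨w, hw, hw₁, hw₂⟩ := h.exists_closedAdj_pos_le hf hs hzs m hsm hlt
      have hw₃ := h.pos_par_le z w hw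
      have hmz : G.ClosedAdj m z := by
        by_contra hmz
        have := hw₂ hmz
        omega
      have hsub : ∀ y, G.ClosedAdj m y → G.ClosedAdj z y := by
        intro y hy
        rcases le_total (f z) (f y) with hzy | hzy
        · exact (hf m z y hlt.le hzy hy).2
        · exact (hf m y z (hmin y (hm.trans hy.reachable)) hzy hmz).2.symm
      have hsib := h.siblings m z hpos (h.inj (by omega)) hmr
      exact fun y => ⟨hsub y, closedAdj_of_ncard_le hsub (hkey _ _ hsib) y⟩
  -- So `z` may be moved to the place of `m`.
  set π : V → V := fun v => if v = z then m else v with hπ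
  have hπadj : ∀ x y, G.ClosedAdj (π x) (π y) ↔ G.ClosedAdj x y := by
    have h₁ : ∀ x y, G.ClosedAdj (π x) y ↔ G.ClosedAdj x y := by
      intro x y
      simp only [hπ]
      split_ifs with hx
      · rw [hx, htwin]
      · rfl
    intro x y
    rw [h₁]
    exact ⟨fun hxy => ((h₁ y x).1 hxy.symm).symm, fun hxy => ((h₁ y x).2 hxy.symm).symm⟩
  refine ⟨fun v => f (π v), fun x y w hxy hyw hxw => ?_, fun y hy => ?_⟩
  · simpa only [hπadj] using hf (π x) (π y) (π w) hxy hyw ((hπadj x w).2 hxw)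
  · have hπz : π z = m := if_pos rfl
    simp only [hπz]
    by_cases hyz : y = z
    · rw [hyz, hπz]
    · rw [show π y = y from if_neg hyz]
      exact hmin y hy

/-- If a breadth-first search starts at an end of a component and visits siblings by ascending
degree, two vertices of the component in the wrong order have the same closed neighbourhood. -/
theorem closedAdj_iff_of_lt [Finite V] (h : G.IsSearchOrder pos par key)
    (hkey : ∀ x y, key y ≤ key x → (G.neighborSet x).ncard ≤ (G.neighborSet y).ncard)
    {f : V → ℝ} (hf : G.IsUmbrella f) {s : V} (hs : par s = s)
    (hmin : ∀ y, G.Reachable s y → f s ≤ f y) (y x : V) (hsy : G.Reachable s y)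
    (hsx : G.Reachable s x) (hyx : pos y < pos x) (hlt : f x < f y) (w : V) :
    G.ClosedAdj x w ↔ G.ClosedAdj y w := by
  induction hn : pos y using Nat.strong_induction_on generalizing y x w with
  | _ n ih =>
    have hy : par y ≠ y := by
      intro hy
      rw [h.eq_root hs hy hsy] at hlt
      exact absurd (hmin x hsx) (not_le.2 hlt)
    set P := par y with hP
    have hPlt : pos P < pos y := h.pos_par_lt hy
    have hPy : G.ClosedAdj P y := h.closedAdj_par y
    have hsP : G.Reachable s P := hsy.trans hPy.symm.reachable
    -- Every vertex of the component that is visited after `P` and lies to the left of `y` is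
    -- adjacent to `y`.
    have hleft : ∀ v, G.Reachable s v → pos P ≤ pos v → f v ≤ f y → G.ClosedAdj v y := by
      intro v hv hPv hvy
      rcases le_or_gt (f P) (f v) with hle | hgt
      · exact (hf P v y hle hvy hPy).2
      · rcases hPv.lt_or_eq with hPv | hPv
        · exact (ih _ (hn ▸ hPlt) P v hsP hv hPv hgt y rfl).2 hPy
        · rw [h.inj hPv] at hgt
          exact absurd hgt (lt_irrefl _)
    have hPx : G.ClosedAdj P x := by
      rcases le_or_gt (f P) (f x) with hle | hgt
      · exact (hf P x y hle hlt.le hPy).1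
      · exact ((ih _ (hn ▸ hPlt) P x hsP hsx (hPlt.trans hyx) hgt P rfl).2 (.refl P)).symm
    have hpar : P = par x :=
      h.inj (le_antisymm (h.mono y x hyx.le) (h.pos_par_le x P hPx))
    have hxy : G.ClosedAdj x y := hleft x hsx (by omega) hlt.le
    have hsub : ∀ w, G.ClosedAdj x w → G.ClosedAdj y w := by
      intro w hw
      rcases le_total (f y) (f w) with hyw | hyw
      · exact (hf x y w hlt.le hyw hw).2
      · refine (hleft w (hsx.trans hw.reachable) ?_ hyw).symm
        rw [hpar]
        exact h.pos_par_le x w hw.symm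
    have hsib := h.siblings y x hyx hpar hy
    exact ⟨hsub w, closedAdj_of_ncard_le hsub (hkey _ _ hsib) w⟩

/-- A breadth-first search that starts every component at an end and visits siblings by ascending
degree arranges the vertices in an umbrella ordering. -/
theorem isUmbrella_pos [Finite V] (h : G.IsSearchOrder pos par key)
    (hkey : ∀ x y, key y ≤ key x → (G.neighborSet x).ncard ≤ (G.neighborSet y).ncard)
    (hroot : ∀ s, par s = s →
      ∃ f : V → ℝ, G.IsUmbrella f ∧ ∀ y, G.Reachable s y → f s ≤ f y) :
    G.IsUmbrella fun v => (pos v : ℝ) := by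
  intro x y z hxy hyz hxz
  simp only [Nat.cast_le] at hxy hyz
  rcases hxy.eq_or_lt with hxy | hxy
  · obtain rfl := h.inj hxy
    exact ⟨.refl x, hxz⟩
  rcases hyz.eq_or_lt with hyz | hyz
  · obtain rfl := h.inj hyz
    exact ⟨hxz, .refl y⟩
  obtain ⟨s, hs, hsx⟩ := h.exists_root x
  obtain ⟨f, hf, hmin⟩ := hroot s hs
  have hsy := hsx.trans (h.reachable_of_lt_of_lt hxy hyz hxz)
  have hsz := hsx.trans hxz.reachable
  have twin := h.closedAdj_iff_of_lt hkey hf hs hmin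
  rcases lt_or_ge (f y) (f x) with hyx | hyx
  · have := twin x y hsx hsy hxy hyx
    exact ⟨(this x).2 (.refl x) |>.symm, (this z).2 hxz⟩
  rcases lt_or_ge (f z) (f y) with hzy | hzy
  · have := twin y z hsy hsz hyz hzy
    exact ⟨((this x).1 hxz.symm).symm, (this y).2 (.refl y) |>.symm⟩
  exact hf x y z hyx hzy hxz

end IsSearchOrder

/-! ### Uniquely restricted matchings along an umbrella ordering -/

/-- `pos` arranges the vertices in an umbrella ordering without ties, and `lo v` is the position
of the first vertex in the closed neighbourhood of `v`. -/
structure IsLayout (G : SimpleGraph V) (pos lo : V → ℕ) : Prop where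
  inj : Function.Injective pos
  mono : ∀ x y, pos x ≤ pos y → lo x ≤ lo y
  adj_iff : ∀ x y, pos x < pos y → (G.Adj x y ↔ lo y ≤ pos x)

theorem IsSearchOrder.isLayout {pos : V → ℕ} {par : V → V} {key : V → ℕ}
    (h : G.IsSearchOrder pos par key) (hu : G.IsUmbrella fun v => (pos v : ℝ)) :
    G.IsLayout pos fun v => pos (par v) where
  inj := h.inj
  mono := h.mono
  adj_iff x y hxy := by
    refine ⟨fun hadj => h.pos_par_le y x (Or.inr hadj), fun hle => ?_⟩
    have := (hu (par y) x y (Nat.cast_le.2 hle) (Nat.cast_le.2 hxy.le) (h.closedAdj_par y)).2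
    exact this.resolve_left fun h' => hxy.ne (by rw [h'])

/-- For edges `e` and `f`, written with the left end first: `e` lies to the left of `f`, and the
left ends or the right ends of the two edges are not adjacent. -/
def Before (pos lo : V → ℕ) (e f : V × V) : Prop :=
  pos e.1 < lo f.1 ∨ pos e.2 < lo f.2

/-- Exchanging the partners of two edges of a uniquely restricted matching never results in a
matching of the graph. -/
theorem Subgraph.IsUniquelyRestricted.not_adj_of_adj {M : G.Subgraph}
    (hM : M.IsUniquelyRestricted) {u v x y : V} (huv : M.Adj u v) (hxy : M.Adj x y)
    (hux : u ≠ x) (hvx : v ≠ x) (h₁ : G.Adj u x) : ¬ G.Adj v y := by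
  classical
  intro h₂
  obtain ⟨hM, huniq⟩ := hM
  have part : ∀ {a b c}, M.Adj a b → M.Adj a c → b = c := fun h h' => hM.eq_of_adj_left h h'
  have huv' : u ≠ v := huv.ne
  have hyv : y ≠ v := by
    rintro rfl
    exact hux (part huv.symm hxy.symm)
  have hyx : y ≠ x := hxy.ne.symm
  set σ : Equiv.Perm V := Equiv.swap v x with hσ
  have hσv : σ v = x := Equiv.swap_apply_left v x
  have hσx : σ x = v := Equiv.swap_apply_right v x
  have hσo : ∀ a, a ≠ v → a ≠ x → σ a = a := fun a h h' => Equiv.swap_apply_of_ne_of_ne h h'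
  have hσσ : ∀ a, σ (σ a) = a := fun a => Equiv.swap_apply_self v x a
  have hverts : ∀ a, σ a ∈ M.verts ↔ a ∈ M.verts := by
    intro a
    by_cases hav : a = v
    · rw [hav, hσv]
      exact iff_of_true (M.edge_vert hxy) (M.edge_vert huv.symm)
    by_cases hax : a = x
    · rw [hax, hσx]
      exact iff_of_true (M.edge_vert huv.symm) (M.edge_vert hxy)
    rw [hσo a hav hax]
  have hleft : ∀ a b, a = v ∨ a = x → M.Adj (σ a) (σ b) → G.Adj a b := by
    rintro a b (rfl | rfl) hab
    · rw [hσv] at hab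
      have : b = y := by rw [← hσσ b, ← part hxy hab, hσo y hyv hyx]
      rwa [this]
    · rw [hσx] at hab
      have : b = u := by rw [← hσσ b, ← part huv.symm hab, hσo u huv' hux]
      rw [this]
      exact h₁.symm
  -- The matching `M` with the vertices `v` and `x` interchanged.
  let M' : G.Subgraph :=
    { verts := M.verts
      Adj := fun a b => M.Adj (σ a) (σ b)
      adj_sub := by
        intro a b hab
        by_cases ha : a = v ∨ a = x
        · exact hleft a b ha hab
        by_cases hb : b = v ∨ b = x
        · exact (hleft b a hb hab.symm).symm
        push Not at ha hb
        rw [hσo a ha.1 ha.2, hσo b hb.1 hb.2] at hab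
        exact M.adj_sub hab
      edge_vert := fun {a b} hab => (hverts a).1 (M.edge_vert hab)
      symm := ⟨fun a b hab => hab.symm⟩ }
  have hM' : M'.IsMatching := by
    intro a ha
    obtain ⟨c, hc, hc'⟩ := hM ((hverts a).2 ha)
    refine ⟨σ c, ?_, fun b hb => ?_⟩
    · change M.Adj (σ a) (σ (σ c))
      rwa [hσσ]
    · rw [← hc' (σ b) hb, hσσ]
  have hadj : M'.Adj u x := by
    change M.Adj (σ u) (σ x)
    rwa [hσx, hσo u huv' hux]
  rw [huniq M' hM' rfl] at hadj
  exact hvx (part huv hadj)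

namespace IsLayout

variable {pos lo : V → ℕ}

theorem lt_of_before (h : G.IsLayout pos lo) {u v x y : V} (huv : pos u < pos v)
    (hxy : pos x < pos y) (hadj : G.Adj u v) (hadj' : G.Adj x y)
    (hb : Before pos lo (u, v) (x, y)) : pos v < pos x := by
  rcases hb with hb | hb
  · by_contra! hle
    have h₁ := h.mono x v hle
    have h₂ := (h.adj_iff u v huv).1 hadj
    simp only at hb
    omega
  · have := (h.adj_iff x y hxy).1 hadj'
    simp only at hb
    omega

/-- A matching is uniquely restricted if and only if its edges lie one after the other, and no two
of them have both their left ends and their right ends adjacent. -/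
theorem isUniquelyRestricted_iff (h : G.IsLayout pos lo) {M : G.Subgraph} (hM : M.IsMatching) :
    M.IsUniquelyRestricted ↔ ∀ u v x y, M.Adj u v → M.Adj x y → pos u < pos v → pos x < pos y →
      pos u < pos x → Before pos lo (u, v) (x, y) := by
  have hne : ∀ {a b}, pos a ≠ pos b → a ≠ b := fun h h' => h (by rw [h'])
  constructor
  · intro hUR u v x y huv hxy huv' hxy' hux
    by_contra hb
    simp only [Before, not_or, not_lt] at hb
    obtain ⟨h₁, h₂⟩ := hb
    have hvx : v ≠ x := by
      rintro rfl
      have := hM.eq_of_adj_left huv.symm hxy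
      rw [this] at hux
      omega
    refine hUR.not_adj_of_adj huv hxy (hne hux.ne) hvx ((h.adj_iff u x hux).2 h₁) ?_
    rcases lt_trichotomy (pos v) (pos y) with hlt | heq | hgt
    · exact (h.adj_iff v y hlt).2 h₂
    · obtain rfl := h.inj heq
      exact absurd (hM.eq_of_adj_left huv.symm hxy.symm) (hne hux.ne)
    · refine ((h.adj_iff y v hgt).2 ?_).symm
      have := (h.adj_iff u v huv').1 (M.adj_sub huv)
      omega
  · intro hbef
    refine ⟨hM, fun M' hM' hverts => ?_⟩
    have part : ∀ {a b c}, M.Adj a b → M.Adj a c → b = c := fun h h' => hM.eq_of_adj_left h h'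
    have part' : ∀ {a b c}, M'.Adj a b → M'.Adj a c → b = c :=
      fun h h' => hM'.eq_of_adj_left h h'
    -- From left to right, every edge of `M` is found to be an edge of `M'`.
    have key : ∀ u v, M.Adj u v → pos u < pos v → M'.Adj u v := by
      intro u v huv huv'
      induction hn : pos u using Nat.strong_induction_on generalizing u v with
      | _ n ih =>
        have hu : u ∈ M'.verts := hverts ▸ M.edge_vert huv
        have hv : v ∈ M'.verts := hverts ▸ M.edge_vert huv.symm
        obtain ⟨w, hw, -⟩ := hM' hu
        obtain ⟨z, hz, -⟩ := hM' hv
        by_cases hwv : w = v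
        · exact hwv ▸ hw
        by_cases hzu : z = u
        · exact (hzu ▸ hz).symm
        -- Edges of `M` to the left of `(u, v)` are edges of `M'`, so the partners of `u` and `v`
        -- in `M'` belong to edges of `M` to the right of it.
        have later : ∀ a w, a = u ∨ a = v → M'.Adj a w → w ≠ u → w ≠ v →
            ∃ x y, M.Adj x y ∧ pos x < pos y ∧ pos u < pos x ∧ (w = x ∨ w = y) := by
          intro a w ha hw hwu hwv
          have hwM : w ∈ M.verts := hverts ▸ M'.edge_vert hw.symm
          obtain ⟨w', hw', -⟩ := hM hwM
          obtain ⟨x, y, hxy, hxy', hwxy⟩ :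
              ∃ x y, M.Adj x y ∧ pos x < pos y ∧ (w = x ∨ w = y) := by
            rcases lt_trichotomy (pos w) (pos w') with hlt | heq | hgt
            · exact ⟨w, w', hw', hlt, Or.inl rfl⟩
            · exact absurd (h.inj heq) hw'.ne
            · exact ⟨w', w, hw'.symm, hgt, Or.inr rfl⟩
          refine ⟨x, y, hxy, hxy', ?_, hwxy⟩
          rcases lt_trichotomy (pos u) (pos x) with hlt | heq | hgt
          · exact hlt
          · obtain rfl := h.inj heq
            obtain rfl := part huv hxy
            exact absurd hwxy (by tauto)
          · exfalso
            have hxy'' := ih (pos x) (hn ▸ hgt) x y hxy hxy' rfl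
            rcases hwxy with rfl | rfl
            · obtain rfl := part' hxy'' hw.symm
              rcases ha with rfl | rfl
              · rw [part huv hxy.symm] at huv'
                omega
              · exact hwu (part huv.symm hxy.symm).symm
            · obtain rfl := part' hxy''.symm hw.symm
              rcases ha with rfl | rfl <;> omega
        obtain ⟨x, y, hxy, hxy', hux, hwxy⟩ := later u w (Or.inl rfl) hw hw.ne.symm hwv
        obtain ⟨x', y', hx'y', hx'y'', hux', hzxy⟩ := later v z (Or.inr rfl) hz hzu hz.ne.symm
        have hb := hbef u v x y huv hxy huv' hxy' hux
        have hb' := hbef u v x' y' huv hx'y' huv' hx'y'' hux'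
        have hvx := h.lt_of_before huv' hxy' (M.adj_sub huv) (M.adj_sub hxy) hb
        have hvx' := h.lt_of_before huv' hx'y'' (M.adj_sub huv) (M.adj_sub hx'y') hb'
        have hposw : pos x ≤ pos w := by rcases hwxy with rfl | rfl <;> omega
        have hposz : pos x' ≤ pos z := by rcases hzxy with rfl | rfl <;> omega
        have hlow : lo w ≤ pos u := (h.adj_iff u w (by omega)).1 (M'.adj_sub hw)
        have hloz : lo z ≤ pos v := (h.adj_iff v z (by omega)).1 (M'.adj_sub hz)
        have hlox := h.mono x w hposw
        have hlox' := h.mono x' z hposz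
        -- The partner of `u` in `M'` cannot be a right end.
        have hwx : w = x ∧ pos v < lo y := by
          have : pos v < lo y := hb.resolve_left (by simp only; omega)
          refine ⟨hwxy.resolve_right ?_, this⟩
          rintro rfl
          omega
        obtain ⟨rfl, hy⟩ := hwx
        exfalso
        rcases lt_trichotomy (pos w) (pos x') with hlt | heq | hgt
        · have hb'' := h.lt_of_before hxy' hx'y'' (M.adj_sub hxy) (M.adj_sub hx'y')
            (hbef w y x' y' hxy hx'y' hxy' hx'y'' hlt)
          have := h.mono y z (by omega)
          omega
        · obtain rfl := h.inj heq
          obtain rfl := part hxy hx'y'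
          rcases hzxy with rfl | rfl
          · exact huv'.ne (congrArg pos (part' hw.symm hz.symm))
          · omega
        · have hb'' := h.lt_of_before hx'y'' hxy' (M.adj_sub hx'y') (M.adj_sub hxy)
            (hbef x' y' w y hx'y' hxy hx'y'' hxy' hgt)
          have h₁ := h.mono x' w (by omega)
          have h₂ := h.mono y' w (by omega)
          have h₃ : pos v < lo y' := hb'.resolve_left (by simp only; omega)
          omega
    have key' : ∀ a b, M.Adj a b → M'.Adj a b := by
      intro a b hab
      rcases lt_trichotomy (pos a) (pos b) with hlt | heq | hgt
      · exact key a b hab hlt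
      · exact absurd (h.inj heq) hab.ne
      · exact (key b a hab.symm hgt).symm
    refine Subgraph.ext hverts ?_
    funext a b
    refine propext ⟨fun hab => ?_, key' a b⟩
    have ha : a ∈ M.verts := hverts ▸ M'.edge_vert hab
    obtain ⟨c, hc, -⟩ := hM ha
    exact part' (key' a c hc) hab ▸ hc

/-- The edges of a uniquely restricted matching, as pairs of positions. -/
theorem exists_finset_of_isUniquelyRestricted [Finite V] (h : G.IsLayout pos lo) {M : G.Subgraph}
    (hM : M.IsUniquelyRestricted) :
    ∃ T : Finset (V × V), T.card = M.edgeSet.ncard ∧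
      (∀ e ∈ T, pos e.1 < pos e.2 ∧ G.Adj e.1 e.2) ∧
      (∀ e ∈ T, ∀ f ∈ T, pos e.1 < pos f.1 → Before pos lo e f) ∧
      ∀ e ∈ T, ∀ f ∈ T, e.1 = f.1 → e = f := by
  classical
  have := Fintype.ofFinite V
  refine ⟨Finset.univ.filter fun e => M.Adj e.1 e.2 ∧ pos e.1 < pos e.2, ?_, ?_, ?_, ?_⟩
  · rw [← Set.ncard_coe_finset]
    refine Set.ncard_congr (fun e _ => s(e.1, e.2)) ?_ ?_ ?_
    · intro e he
      simp only [Finset.coe_filter, Finset.mem_univ, true_and, Set.mem_ofPred_eq] at he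
      exact he.1
    · rintro ⟨u, v⟩ ⟨x, y⟩ he hf hef
      simp only [Finset.coe_filter, Finset.mem_univ, true_and, Set.mem_ofPred_eq] at he hf
      rcases Sym2.eq_iff.1 hef with ⟨rfl, rfl⟩ | ⟨rfl, rfl⟩
      · rfl
      · have h₁ := he.2
        have h₂ := hf.2
        simp only at h₁ h₂
        omega
    · intro e
      induction e using Sym2.ind with
      | _ u v =>
        intro he
        have he : M.Adj u v := he
        rcases lt_trichotomy (pos u) (pos v) with hlt | heq | hgt
        · exact ⟨(u, v), by simpa using ⟨he, hlt⟩, rfl⟩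
        · exact absurd (h.inj heq) he.ne
        · exact ⟨(v, u), by simpa using ⟨he.symm, hgt⟩, Sym2.eq_swap⟩
  · simp only [Finset.mem_filter, Finset.mem_univ, true_and]
    exact fun e he => ⟨he.2, M.adj_sub he.1⟩
  · simp only [Finset.mem_filter, Finset.mem_univ, true_and]
    exact fun e he f hf => (h.isUniquelyRestricted_iff hM.1).1 hM _ _ _ _ he.1 hf.1 he.2 hf.2
  · simp only [Finset.mem_filter, Finset.mem_univ, true_and]
    rintro ⟨u, v⟩ he ⟨x, y⟩ hf heq
    obtain rfl : u = x := heq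
    exact congrArg (Prod.mk u) (hM.1.eq_of_adj_left he.1 hf.1)

/-- A sequence of edges from right to left, each of them before its predecessors, makes up a
uniquely restricted matching. -/
theorem exists_isUniquelyRestricted_of_list (h : G.IsLayout pos lo) {l : List (V × V)}
    (hl : ∀ e ∈ l, pos e.1 < pos e.2 ∧ G.Adj e.1 e.2)
    (hp : l.Pairwise fun f e => Before pos lo e f) :
    ∃ M : G.Subgraph, M.IsUniquelyRestricted ∧ (l.map fun p => s(p.1, p.2)).Nodup ∧
      ∀ e, e ∈ M.edgeSet ↔ e ∈ l.map fun p => s(p.1, p.2) := by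
  have hlt : ∀ e ∈ l, ∀ f ∈ l, Before pos lo e f → pos e.2 < pos f.1 := fun e he f hf =>
    h.lt_of_before (hl e he).1 (hl f hf).1 (hl e he).2 (hl f hf).2
  have hcomp : ∀ e ∈ l, ∀ f ∈ l, e ≠ f → Before pos lo e f ∨ Before pos lo f e := by
    have : Std.Symm fun e f : V × V => Before pos lo e f ∨ Before pos lo f e :=
      ⟨fun _ _ h => h.symm⟩
    intro e he f hf
    exact List.Pairwise.forall (R := fun e f => Before pos lo e f ∨ Before pos lo f e)
      (hp.imp Or.inr) he hf
  have hdisj : ∀ e ∈ l, ∀ f ∈ l, e.1 = f.1 ∨ e.1 = f.2 ∨ e.2 = f.1 ∨ e.2 = f.2 → e = f := by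
    intro e he f hf hef
    by_contra hne
    have h₁ := (hl e he).1
    have h₂ := (hl f hf).1
    have h₃ : pos e.2 < pos f.1 ∨ pos f.2 < pos e.1 :=
      (hcomp e he f hf hne).imp (hlt e he f hf) (hlt f hf e he)
    rcases hef with hef | hef | hef | hef <;> have := congrArg pos hef <;> omega
  let M : G.Subgraph :=
    { verts := {x | ∃ e ∈ l, x = e.1 ∨ x = e.2}
      Adj := fun x y => (x, y) ∈ l ∨ (y, x) ∈ l
      adj_sub := by
        rintro x y (hxy | hxy)
        exacts [(hl _ hxy).2, (hl _ hxy).2.symm]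
      edge_vert := by
        rintro x y (hxy | hxy)
        exacts [⟨_, hxy, Or.inl rfl⟩, ⟨_, hxy, Or.inr rfl⟩]
      symm := ⟨fun x y hxy => hxy.symm⟩ }
  have hord : ∀ x y, M.Adj x y → pos x < pos y → (x, y) ∈ l := by
    rintro x y (hxy | hxy) hlt
    · exact hxy
    · have := (hl _ hxy).1
      simp only at this
      omega
  have hM : M.IsMatching := by
    rintro x ⟨⟨a, b⟩, he, hx⟩
    rcases hx with rfl | rfl
    · refine ⟨b, Or.inl he, fun c hc => ?_⟩
      rcases hc with hc | hc
      · have := hdisj _ he _ hc (by simp)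
        simp_all
      · have := hdisj _ he _ hc (by simp)
        simp_all
    · refine ⟨a, Or.inr he, fun c hc => ?_⟩
      rcases hc with hc | hc
      · have := hdisj _ he _ hc (by simp)
        simp_all
      · have := hdisj _ he _ hc (by simp)
        simp_all
  refine ⟨M, (h.isUniquelyRestricted_iff hM).2 ?_, ?_, ?_⟩
  · intro u v x y huv hxy huv' hxy' hux
    have he := hord u v huv huv'
    have hf := hord x y hxy hxy'
    refine (hcomp _ he _ hf ?_).resolve_right fun hb => ?_
    · rintro ⟨⟩
      omega
    · have := hlt _ hf _ he hb
      simp only at this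
      omega
  · rw [List.Nodup, List.pairwise_map]
    refine hp.imp_of_mem fun {e f} he hf hb hef => ?_
    have h₁ := hlt _ hf _ he hb
    have h₂ := (hl e he).1
    have h₃ := (hl f hf).1
    rcases Sym2.eq_iff.1 hef with ⟨h₄, h₅⟩ | ⟨h₄, h₅⟩ <;> have := congrArg pos h₄ <;> omega
  · intro e
    induction e using Sym2.ind with
    | _ x y =>
      change (x, y) ∈ l ∨ (y, x) ∈ l ↔ _
      simp only [List.mem_map, Prod.exists]
      constructor
      · rintro (hxy | hxy)
        exacts [⟨x, y, hxy, rfl⟩, ⟨y, x, hxy, Sym2.eq_swap⟩]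
      · rintro ⟨a, b, hab, heq⟩
        rcases Sym2.eq_iff.1 heq with ⟨rfl, rfl⟩ | ⟨rfl, rfl⟩
        exacts [Or.inl hab, Or.inr hab]

end IsLayout

end SimpleGraph

/-! ### The longest sequence of edges -/

/-- The layout of a graph on the positions `0, …, n - 1`: the closed neighbourhood of position `i`
is made up of the positions from `L i` up to, and not including, `R i`. -/
structure IsRange (n : ℕ) (L R : ℕ → ℕ) : Prop where
  le : ∀ j < n, L j ≤ j
  mono : ∀ i j, i ≤ j → j < n → L i ≤ L j
  R_le : ∀ i < n, R i ≤ n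
  lt_R_iff : ∀ i < n, ∀ j < n, j < R i ↔ L j ≤ i

/-- `e` is an edge between positions, the left end first. -/
def IsEdge (n : ℕ) (L : ℕ → ℕ) (e : ℕ × ℕ) : Prop := e.1 < e.2 ∧ e.2 < n ∧ L e.2 ≤ e.1

/-- The relation `SimpleGraph.Before` for edges between positions. -/
def PosBefore (L : ℕ → ℕ) (e f : ℕ × ℕ) : Prop := e.1 < L f.1 ∨ e.2 < L f.2

/-- The table of the dynamic program: `a p` and `b p` are the largest numbers of edges in a
sequence in which every edge is before the next one and all left ends, or all right ends, are
smaller than `p`.  An edge that is as far to the right as possible under the respective constraint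
joins `p` to its last neighbour, or `p - 1` to `p`; the edges before an edge `(u, v)` all have
left ends smaller than `L u`, or all have right ends smaller than `L v`. -/
structure IsTable (n : ℕ) (L R a b : ℕ → ℕ) : Prop where
  a_zero : a 0 = 0
  b_zero : b 0 = 0
  a_succ : ∀ p < n, a (p + 1) = if p < R p - 1 then max (a (L p)) (b (L (R p - 1))) + 1 else a p
  b_succ : ∀ p < n, b (p + 1) = if L p < p then max (a (L (p - 1))) (b (L p)) + 1 else b p

theorem PosBefore.lt {n : ℕ} {L R : ℕ → ℕ} (h : IsRange n L R) {e f : ℕ × ℕ} (he : IsEdge n L e)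
    (hf : IsEdge n L f) (hb : PosBefore L e f) : e.2 < f.1 := by
  obtain ⟨he₁, he₂, he₃⟩ := he
  obtain ⟨hf₁, hf₂, hf₃⟩ := hf
  rcases hb with hb | hb
  · by_contra! hle
    have := h.mono f.1 e.2 hle he₂
    omega
  · omega

/-- The dynamic program may compute the table from left to right. -/
theorem IsTable.succ {n p : ℕ} {L R a b : ℕ → ℕ} (ht : IsTable p L R a b)
    (h : IsRange n L R) (hp : p < n) {a' b' : ℕ → ℕ}
    (hb' : b' = Function.update b (p + 1)
      (if L p < p then max (a (L (p - 1))) (b (L p)) + 1 else b p))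
    (ha' : a' = Function.update a (p + 1)
      (if p < R p - 1 then max (a (L p)) (b' (L (R p - 1))) + 1 else a p)) :
    IsTable (p + 1) L R a' b' := by
  have ha : ∀ q ≤ p, a' q = a q := fun q hq => by rw [ha', Function.update_of_ne (by omega)]
  have hb : ∀ q ≤ p, b' q = b q := fun q hq => by rw [hb', Function.update_of_ne (by omega)]
  have hLR : ∀ q ≤ p, q < R q - 1 → L (R q - 1) ≤ q := fun q hq hqR =>
    (h.lt_R_iff q (by omega) _ (by have := h.R_le q (by omega); omega)).1 (by omega)
  have hL : ∀ q ≤ p, L q ≤ q := fun q hq => h.le q (by omega)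
  refine ⟨by rw [ha 0 (by omega), ht.a_zero], by rw [hb 0 (by omega), ht.b_zero], ?_, ?_⟩
  · intro q hq
    rw [ha q (by omega), ha (L q) (by have := hL q (by omega); omega)]
    rcases Nat.lt_succ_iff_lt_or_eq.1 hq with hq | rfl
    · rw [ha (q + 1) (by omega), ht.a_succ q hq]
      split_ifs with hR
      · rw [hb _ (by have := hLR q hq.le hR; omega)]
      · rfl
    · rw [ha', Function.update_self]
  · intro q hq
    rw [hb q (by omega), hb (L q) (by have := hL q (by omega); omega),
      ha (L (q - 1)) (by have := hL (q - 1) (by omega); omega)]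
    rcases Nat.lt_succ_iff_lt_or_eq.1 hq with hq | rfl
    · rw [hb (q + 1) (by omega), ht.b_succ q hq]
    · rw [hb', Function.update_self]

/-- If `f` is the last edge of a sequence and `g` the one before it, either all left ends up to `g`
are smaller than `L f.1`, or all right ends are smaller than `L f.2`. -/
theorem IsRange.card_le_max_add_one {n : ℕ} {L R : ℕ → ℕ} (h : IsRange n L R)
    {T : Finset (ℕ × ℕ)} (hT : ∀ e ∈ T, IsEdge n L e)
    (hb : ∀ e ∈ T, ∀ f ∈ T, e.1 < f.1 → PosBefore L e f)
    (hinj : ∀ e ∈ T, ∀ f ∈ T, e.1 = f.1 → e = f) {S : Finset (ℕ × ℕ)} (hS : S ⊆ T) {u v : ℕ}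
    (hu : u < n) (hv : v < n) (hSu : ∀ e ∈ S, e.1 ≤ u) (hSv : ∀ e ∈ S, e.2 ≤ v) :
    S.card ≤ max (T.filter fun e => e.1 < L u).card (T.filter fun e => e.2 < L v).card + 1 := by
  rcases S.eq_empty_or_nonempty with rfl | hne
  · simp
  obtain ⟨f, hf, hfmax⟩ := S.exists_max_image Prod.fst hne
  rw [← Finset.card_erase_add_one hf]
  refine Nat.add_le_add_right ?_ 1
  rcases (S.erase f).eq_empty_or_nonempty with hem | hne'
  · simp [hem]
  obtain ⟨g, hg, hgmax⟩ := (S.erase f).exists_max_image Prod.fst hne'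
  have hgS := Finset.mem_of_mem_erase hg
  have hgf : g.1 < f.1 := lt_of_le_of_ne (hfmax g hgS) fun heq =>
    (Finset.ne_of_mem_erase hg) (hinj _ (hS hgS) _ (hS hf) heq)
  rcases hb g (hS hgS) f (hS hf) hgf with hlt | hlt
  · refine le_max_of_le_left (Finset.card_le_card fun e he => ?_)
    have h₁ := hgmax e he
    have h₂ := h.mono f.1 u (hSu f hf) hu
    exact Finset.mem_filter.2 ⟨hS (Finset.mem_of_mem_erase he), by omega⟩
  · refine le_max_of_le_right (Finset.card_le_card fun e he => ?_)
    have heT := hS (Finset.mem_of_mem_erase he)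
    have h₂ := h.mono f.2 v (hSv f hf) hv
    have h₃ : e.2 ≤ g.2 := by
      rcases (hgmax e he).eq_or_lt with heq | hlt'
      · rw [hinj e heT g (hS hgS) heq]
      · have h₄ := (hb e heT g (hS hgS) hlt').lt h (hT e heT) (hT g (hS hgS))
        have h₅ := (hT g (hS hgS)).1
        omega
    exact Finset.mem_filter.2 ⟨heT, by omega⟩

/-- The entries of the table are upper bounds for the lengths of the sequences. -/
theorem IsTable.card_filter_le {n : ℕ} {L R a b : ℕ → ℕ} (ht : IsTable n L R a b)
    (h : IsRange n L R) {T : Finset (ℕ × ℕ)} (hT : ∀ e ∈ T, IsEdge n L e)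
    (hb : ∀ e ∈ T, ∀ f ∈ T, e.1 < f.1 → PosBefore L e f)
    (hinj : ∀ e ∈ T, ∀ f ∈ T, e.1 = f.1 → e = f) (p : ℕ) (hp : p ≤ n) :
    (T.filter fun e => e.1 < p).card ≤ a p ∧ (T.filter fun e => e.2 < p).card ≤ b p := by
  induction p using Nat.strong_induction_on with
  | _ p ih =>
    rcases p with _ | p
    · simp
    have hp' : p < n := hp
    constructor
    · rw [ht.a_succ p hp']
      split_ifs with hR
      · have hlast : ∀ e ∈ T, e.1 ≤ p → e.2 ≤ R p - 1 := by
          intro e he hep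
          have := (h.lt_R_iff p hp' e.2 (hT e he).2.1).2 ((hT e he).2.2.trans hep)
          omega
        have hRn := h.R_le p hp'
        have hLR : L (R p - 1) ≤ p := (h.lt_R_iff p hp' (R p - 1) (by omega)).1 (by omega)
        have h₁ := h.card_le_max_add_one hT hb hinj (Finset.filter_subset (fun e => e.1 < p + 1) T)
          (u := p) (v := R p - 1) hp' (by omega)
          (fun e he => by have := (Finset.mem_filter.1 he).2; omega)
          (fun e he => hlast e (Finset.mem_filter.1 he).1
            (by have := (Finset.mem_filter.1 he).2; omega))
        have h₂ := (ih (L p) (by have := h.le p hp'; omega) (by have := h.le p hp'; omega)).1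
        have h₃ := (ih (L (R p - 1)) (by omega) (by omega)).2
        exact h₁.trans (Nat.add_le_add_right (max_le_max h₂ h₃) 1)
      · refine le_trans (Finset.card_le_card fun e he => ?_) (ih p (by omega) (by omega)).1
        obtain ⟨he, hep⟩ := Finset.mem_filter.1 he
        refine Finset.mem_filter.2 ⟨he, lt_of_le_of_ne (by omega) fun heq => ?_⟩
        obtain ⟨h₁, h₂, h₃⟩ := hT e he
        have := (h.lt_R_iff p hp' e.2 h₂).2 (by omega)
        omega
    · rw [ht.b_succ p hp']
      split_ifs with hL
      · have h₁ := h.card_le_max_add_one hT hb hinj (Finset.filter_subset (fun e => e.2 < p + 1) T)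
          (u := p - 1) (v := p) (by omega) hp'
          (fun e he => by
            have := (Finset.mem_filter.1 he).2
            have := (hT e (Finset.mem_filter.1 he).1).1
            omega)
          (fun e he => by have := (Finset.mem_filter.1 he).2; omega)
        have h₄ := h.le (p - 1) (by omega)
        have h₂ := (ih (L (p - 1)) (by omega) (by omega)).1
        have h₃ := (ih (L p) (by omega) (by omega)).2
        exact h₁.trans (Nat.add_le_add_right (max_le_max h₂ h₃) 1)
      · refine le_trans (Finset.card_le_card fun e he => ?_) (ih p (by omega) (by omega)).2
        obtain ⟨he, hep⟩ := Finset.mem_filter.1 he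
        refine Finset.mem_filter.2 ⟨he, lt_of_le_of_ne (by omega) fun heq => ?_⟩
        obtain ⟨h₁, h₂, h₃⟩ := hT e he
        rw [heq] at h₃
        omega

/-- Any uniquely restricted matching has at most `b n` edges. -/
theorem IsTable.ncard_edgeSet_le {V : Type*} [Finite V] {G : SimpleGraph V} {pos lo : V → ℕ}
    (hG : G.IsLayout pos lo) {n : ℕ} {L R a b : ℕ → ℕ} (ht : IsTable n L R a b)
    (h : IsRange n L R) (hpos : ∀ v, pos v < n) (hlo : ∀ v, L (pos v) = lo v) {M : G.Subgraph}
    (hM : M.IsUniquelyRestricted) : M.edgeSet.ncard ≤ b n := by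
  obtain ⟨T, hcard, hT, hb, hinj⟩ := hG.exists_finset_of_isUniquelyRestricted hM
  have hemb : Function.Injective (Prod.map pos pos) := hG.inj.prodMap hG.inj
  have key := (ht.card_filter_le h (T := T.map ⟨_, hemb⟩) ?_ ?_ ?_ n le_rfl).2
  · rw [Finset.filter_true_of_mem, Finset.card_map, hcard] at key
    · exact key
    · simp only [Finset.mem_map, Function.Embedding.coeFn_mk]
      rintro _ ⟨e, -, rfl⟩
      exact hpos _
  · simp only [Finset.mem_map, Function.Embedding.coeFn_mk]
    rintro _ ⟨e, he, rfl⟩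
    refine ⟨(hT e he).1, hpos _, ?_⟩
    simp only [Prod.map_fst, Prod.map_snd, hlo]
    exact (hG.adj_iff _ _ (hT e he).1).1 (hT e he).2
  · simp only [Finset.mem_map, Function.Embedding.coeFn_mk]
    rintro _ ⟨e, he, rfl⟩ _ ⟨f, hf, rfl⟩ hlt
    simp only [PosBefore, Prod.map_fst, Prod.map_snd, hlo]
    exact hb e he f hf hlt
  · simp only [Finset.mem_map, Function.Embedding.coeFn_mk]
    rintro _ ⟨e, he, rfl⟩ _ ⟨f, hf, rfl⟩ heq
    rw [hinj e he f hf (hG.inj heq)]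

/-- The state of the construction of a longest sequence of edges from right to left: the edges in
`l` have been chosen, and it remains to choose a longest sequence of edges with left ends, if
`m ≠ 0`, or right ends, if `m = 0`, smaller than `p`. -/
structure IsPartial (n : ℕ) (L a b : ℕ → ℕ) (p m : ℕ) (l : List (ℕ × ℕ)) : Prop where
  le : p ≤ n
  isEdge : ∀ e ∈ l, IsEdge n L e
  pairwise : l.Pairwise fun f e => PosBefore L e f
  le_of_zero : m = 0 → ∀ e ∈ l, p ≤ L e.2
  le_of_ne : m ≠ 0 → ∀ e ∈ l, p ≤ L e.1
  length_add : l.length + (if m = 0 then b p else a p) = b n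

namespace IsPartial

variable {n : ℕ} {L R a b : ℕ → ℕ} {p m : ℕ} {l : List (ℕ × ℕ)}

theorem nil : IsPartial n L a b n 0 [] := by
  constructor <;> simp

theorem length_eq (h : IsPartial n L a b 0 m l) (ht : IsTable n L R a b) : l.length = b n := by
  have := h.length_add
  rw [ht.a_zero, ht.b_zero] at this
  simpa using this

theorem skip_of_zero (h : IsPartial n L a b (p + 1) m l) (ht : IsTable n L R a b) (hm : m = 0)
    (hp : ¬ L p < p) : IsPartial n L a b p m l := by
  refine ⟨by have := h.le; omega, h.isEdge, h.pairwise, fun hm e he => ?_, fun hm e he => ?_, ?_⟩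
  · have := h.le_of_zero hm e he; omega
  · have := h.le_of_ne hm e he; omega
  · have := h.length_add
    rw [if_pos hm] at this ⊢
    rwa [ht.b_succ p h.le, if_neg hp] at this

theorem skip_of_ne (h : IsPartial n L a b (p + 1) m l) (ht : IsTable n L R a b) (hm : m ≠ 0)
    (hp : ¬ p < R p - 1) : IsPartial n L a b p m l := by
  refine ⟨by have := h.le; omega, h.isEdge, h.pairwise, fun hm e he => ?_, fun hm e he => ?_, ?_⟩
  · have := h.le_of_zero hm e he; omega
  · have := h.le_of_ne hm e he; omega
  · have := h.length_add
    rw [if_neg hm] at this ⊢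
    rwa [ht.a_succ p h.le, if_neg hp] at this

/-- Choosing an edge `(u, v)`, and continuing with the better of the two ways to be before it. -/
theorem choose (h : IsPartial n L a b p m l) (hr : IsRange n L R) {u v : ℕ}
    (he : IsEdge n L (u, v)) (hum : m ≠ 0 → u < p) (hvm : m = 0 → v < p)
    (hval : (if m = 0 then b p else a p) = max (a (L u)) (b (L v)) + 1) :
    (a (L u) < b (L v) → IsPartial n L a b (L v) 0 (l ++ [(u, v)])) ∧
    (¬ a (L u) < b (L v) → IsPartial n L a b (L u) 1 (l ++ [(u, v)])) := by
  obtain ⟨huv, hv, hL⟩ := he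
  have hLu : L u ≤ u := hr.le u (by omega)
  simp only at huv hv hL
  have hb : ∀ f ∈ l, PosBefore L (u, v) f := by
    intro f hf
    by_cases hm : m = 0
    · exact Or.inr ((hvm hm).trans_le (h.le_of_zero hm f hf))
    · exact Or.inl ((hum hm).trans_le (h.le_of_ne hm f hf))
  have hedge : ∀ e ∈ l ++ [(u, v)], IsEdge n L e := by
    intro e he
    rcases List.mem_append.1 he with he | he
    · exact h.isEdge e he
    · rw [List.mem_singleton.1 he]
      exact ⟨huv, hv, hL⟩
  have hpw : (l ++ [(u, v)]).Pairwise fun f e => PosBefore L e f := by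
    rw [List.pairwise_append]
    refine ⟨h.pairwise, List.pairwise_singleton _ _, fun f hf e he => ?_⟩
    rw [List.mem_singleton.1 he]
    exact hb f hf
  have hfar : ∀ f ∈ l ++ [(u, v)], L u ≤ L f.1 ∧ L v ≤ L f.2 := by
    intro f hf
    have hfe := hedge f hf
    rcases List.mem_append.1 hf with hf | hf
    · have h₁ := (hb f hf).lt hr ⟨huv, hv, hL⟩ hfe
      obtain ⟨h₂, h₃, h₄⟩ := hfe
      simp only at h₁
      exact ⟨hr.mono _ _ (by omega) (by omega), hr.mono _ _ (by omega) (by omega)⟩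
    · rw [List.mem_singleton.1 hf]
      exact ⟨le_rfl, le_rfl⟩
  have hlen := h.length_add
  rw [hval] at hlen
  refine ⟨fun hlt => ⟨by omega, hedge, hpw, fun _ f hf => (hfar f hf).2, fun h => absurd rfl h, ?_⟩,
    fun hle => ⟨by omega, hedge, hpw, fun h => absurd h one_ne_zero, fun _ f hf => (hfar f hf).1,
      ?_⟩⟩
  · rw [max_eq_right hlt.le] at hlen
    simp only [List.length_append, List.length_singleton, if_true]
    omega
  · rw [max_eq_left (not_lt.1 hle)] at hlen
    simp only [List.length_append, List.length_singleton, one_ne_zero, if_false]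
    omega

end IsPartial

namespace RAM

/-! ### Linked lists -/

/-- `p` points into the chain of the cells with key `k` that lie below `b`: it is `e + 1` for the
last such cell `e`, or `0` if there is none. -/
structure IsPtr (key : ℕ → ℕ) (k b p : ℕ) : Prop where
  le : p ≤ b
  ne : ∀ e < b, p ≤ e → key e ≠ k
  eq : p ≠ 0 → key (p - 1) = k

/-- The cells `0, …, E - 1` are distributed over linked lists according to their keys: `head k`
points to the last cell with key `k`, and `nxt e` to the last cell before `e` with the same key. -/
structure IsLinked (E : ℕ) (key nxt head : ℕ → ℕ) : Prop where
  head : ∀ k, IsPtr key k E (head k)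
  nxt : ∀ e < E, IsPtr key (key e) e (nxt e)

theorem IsLinked.zero {key nxt head : ℕ → ℕ} (h : ∀ k, head k = 0) : IsLinked 0 key nxt head := by
  refine ⟨fun k => ⟨(h k).le, ?_, fun h' => absurd (h k) h'⟩, ?_⟩ <;> intro e he <;> omega

theorem IsLinked.push {E : ℕ} {key nxt head : ℕ → ℕ} (h : IsLinked E key nxt head) (k : ℕ) :
    IsLinked (E + 1) (Function.update key E k) (Function.update nxt E (head k))
      (Function.update head k (E + 1)) := by
  have hkey : ∀ e < E, Function.update key E k e = key e := fun e he =>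
    Function.update_of_ne (by omega) _ _
  have hptr : ∀ {k' b p}, b ≤ E → IsPtr key k' b p → IsPtr (Function.update key E k) k' b p := by
    intro k' b p hb hp
    have := hp.le
    refine ⟨hp.le, fun e he hpe => ?_, fun h0 => ?_⟩
    · rw [hkey e (by omega)]
      exact hp.ne e he hpe
    · rw [hkey _ (by omega)]
      exact hp.eq h0
  constructor
  · intro k'
    by_cases hk : k' = k
    · subst hk
      rw [Function.update_self]
      refine ⟨le_rfl, fun e he he' => by omega, fun _ => ?_⟩
      rw [Nat.add_sub_cancel, Function.update_self]
    · rw [Function.update_of_ne hk]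
      have hp := hptr le_rfl (h.head k')
      refine ⟨hp.le.trans (Nat.le_succ E), fun e he hpe => ?_, hp.eq⟩
      rcases Nat.lt_succ_iff_lt_or_eq.1 he with he | rfl
      · exact hp.ne e he hpe
      · rw [Function.update_self]
        exact Ne.symm hk
  · intro e he
    rcases Nat.lt_succ_iff_lt_or_eq.1 he with he | rfl
    · rw [hkey e he, Function.update_of_ne (by omega)]
      exact hptr he.le (h.nxt e he)
    · rw [Function.update_self, Function.update_self]
      exact hptr le_rfl (h.head k)

/-! ### Sorting the adjacency lists -/

/-- The adjacency list of the graph with adjacency relation `A` on `0, …, n - 1`: the neighbours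
of `v` are in the cells of `N` with indices from `X v` up to, and not including, `X (v + 1)`. -/
structure IsInput (n : ℕ) (A : ℕ → ℕ → Prop) (X N : ℕ → ℕ) : Prop where
  symm : ∀ u v, A u v → A v u
  lt : ∀ u v, A u v → u < n
  zero : X 0 = 0
  le_succ : ∀ v < n, X v ≤ X (v + 1)
  adj : ∀ v < n, ∀ q, X v ≤ q → q < X (v + 1) → A v (N q)
  exists_of_adj : ∀ u v, A u v → ∃ q, X u ≤ q ∧ q < X (u + 1) ∧ N q = v

theorem IsInput.mono {n : ℕ} {A : ℕ → ℕ → Prop} {X N : ℕ → ℕ} (h : IsInput n A X N) {u v : ℕ}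
    (huv : u ≤ v) (hv : v ≤ n) : X u ≤ X v := by
  induction v, huv using Nat.le_induction with
  | base => exact le_rfl
  | succ v _ ih => exact (ih (by omega)).trans (h.le_succ v (by omega))

/-- The directed edges have been distributed over buckets: edge `q` has source `src q` and target
`N q`, and its key is the value of `kf` at its source. -/
structure IsBuckets (n : ℕ) (A : ℕ → ℕ → Prop) (N kf : ℕ → ℕ) (m : ℕ)
    (src key nxt head : ℕ → ℕ) : Prop where
  adj : ∀ q < m, A (src q) (N q)
  key_eq : ∀ q < m, key q = kf (src q)
  exists_of_adj : ∀ u v, A u v → ∃ q < m, src q = u ∧ N q = v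
  linked : IsLinked m key nxt head

/-- The invariant of the loop that fills the buckets: `v` is the source of the next edge `p`. -/
structure IsFilling (n : ℕ) (X kf : ℕ → ℕ) (v p : ℕ) (src key nxt head : ℕ → ℕ) : Prop where
  v_le : v ≤ n
  le_p : X v ≤ p
  p_le : p ≤ X n
  src_lt : ∀ q < p, src q < n
  le_of_src : ∀ q < p, X (src q) ≤ q
  lt_of_src : ∀ q < p, q < X (src q + 1)
  key_eq : ∀ q < p, key q = kf (src q)
  linked : IsLinked p key nxt head

namespace IsFilling

variable {n : ℕ} {A : ℕ → ℕ → Prop} {X N kf : ℕ → ℕ} {v p : ℕ} {src key nxt head : ℕ → ℕ}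

theorem init (hX : IsInput n A X N) (hhead : ∀ k, head k = 0) :
    IsFilling n X kf 0 0 src key nxt head := by
  refine ⟨Nat.zero_le _, hX.zero.le, Nat.zero_le _, ?_, ?_, ?_, ?_, .zero hhead⟩ <;>
    intro q hq <;> omega

theorem edge (h : IsFilling n X kf v p src key nxt head) (hX : IsInput n A X N) (hv : v < n)
    (hp : p < X (v + 1)) :
    IsFilling n X kf v (p + 1) (Function.update src p v) (Function.update key p (kf v))
      (Function.update nxt p (head (kf v))) (Function.update head (kf v) (p + 1)) := by
  have hX' := hX.mono (u := v + 1) hv le_rfl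
  have hle := h.le_p
  refine ⟨h.v_le, by omega, by omega, ?_, ?_, ?_, ?_, h.linked.push _⟩ <;> intro q hq <;>
    rcases Nat.lt_succ_iff_lt_or_eq.1 hq with hq | rfl
  · rw [Function.update_of_ne (by omega)]
    exact h.src_lt q hq
  · rwa [Function.update_self]
  · rw [Function.update_of_ne (by omega)]
    exact h.le_of_src q hq
  · rwa [Function.update_self]
  · rw [Function.update_of_ne (by omega)]
    exact h.lt_of_src q hq
  · rwa [Function.update_self]
  · rw [Function.update_of_ne (by omega), Function.update_of_ne (by omega)]
    exact h.key_eq q hq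
  · rw [Function.update_self, Function.update_self]

theorem next (h : IsFilling n X kf v p src key nxt head) (hv : v < n) (hp : ¬ p < X (v + 1)) :
    IsFilling n X kf (v + 1) p src key nxt head :=
  { h with
    v_le := hv
    le_p := by omega }

theorem isBuckets (h : IsFilling n X kf v p src key nxt head) (hX : IsInput n A X N)
    (hv : ¬ v < n) : IsBuckets n A N kf (X n) src key nxt head := by
  obtain rfl : v = n := le_antisymm h.v_le (not_lt.1 hv)
  obtain rfl : p = X v := le_antisymm h.p_le h.le_p
  refine ⟨fun q hq => hX.adj _ (h.src_lt q hq) q (h.le_of_src q hq) (h.lt_of_src q hq), h.key_eq,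
    fun u w huw => ?_, h.linked⟩
  obtain ⟨q, hq₁, hq₂, hq₃⟩ := hX.exists_of_adj u w huw
  have hu := hX.lt u w huw
  have hq : q < X v := hq₂.trans_le (hX.mono (u := u + 1) hu le_rfl)
  refine ⟨q, hq, ?_, hq₃⟩
  have h₁ := h.src_lt q hq
  have h₂ := h.le_of_src q hq
  have h₃ := h.lt_of_src q hq
  rcases lt_trichotomy (src q) u with hlt | heq | hgt
  · have := hX.mono (u := src q + 1) (v := u) hlt hu.le
    omega
  · exact heq
  · have := hX.mono (u := u + 1) (v := src q) hgt h₁.le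
    omega

end IsFilling

/-- The adjacency lists as linked lists: cell `e` belongs to the list of `key e` and holds its
neighbour `val e`.  The cells are sorted by the value of `kf` at the neighbour. -/
structure IsSorted (n : ℕ) (A : ℕ → ℕ → Prop) (kf : ℕ → ℕ) (E : ℕ) (val key nxt head : ℕ → ℕ) :
    Prop where
  adj : ∀ e < E, A (val e) (key e)
  exists_of_adj : ∀ u v, A u v → ∃ e < E, val e = u ∧ key e = v
  sorted : ∀ e e', e ≤ e' → e' < E → kf (val e) ≤ kf (val e')
  linked : IsLinked E key nxt head

/-- The edges in the buckets that are still to be visited when the pointer `p` has been reached in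
bucket `d`. -/
def todoBuckets (key : ℕ → ℕ) (m d p : ℕ) : Finset ℕ :=
  (Finset.range m).filter fun q => d < key q ∨ (key q = d ∧ q < p)

/-- The invariant of the loop that empties the buckets, one after the other, and appends the
edges to the lists of their targets. -/
structure IsEmptying (n : ℕ) (A : ℕ → ℕ → Prop) (N kf : ℕ → ℕ) (m : ℕ) (src key₁ : ℕ → ℕ)
    (d p E : ℕ) (val key nxt head : ℕ → ℕ) : Prop where
  d_le : d ≤ n + 1
  p_le : p ≤ m
  key_ptr : p ≠ 0 → key₁ (p - 1) = d
  adj : ∀ e < E, A (val e) (key e)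
  kf_le : ∀ e < E, kf (val e) ≤ d
  sorted : ∀ e e', e ≤ e' → e' < E → kf (val e) ≤ kf (val e')
  exists_of_notMem : ∀ q < m, q ∉ todoBuckets key₁ m d p → ∃ e < E, val e = src q ∧ key e = N q
  linked : IsLinked E key nxt head
  card : E + (todoBuckets key₁ m d p).card = m

namespace IsEmptying

variable {n : ℕ} {A : ℕ → ℕ → Prop} {N kf : ℕ → ℕ} {m : ℕ} {src key₁ nxt₁ head₁ : ℕ → ℕ}
  {d p E : ℕ} {val key nxt head : ℕ → ℕ}

theorem init (hB : IsBuckets n A N kf m src key₁ nxt₁ head₁) (hhead : ∀ k, head k = 0) :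
    IsEmptying n A N kf m src key₁ 0 (head₁ 0) 0 val key nxt head := by
  have hptr := hB.linked.head 0
  have hall : todoBuckets key₁ m 0 (head₁ 0) = Finset.range m := by
    refine Finset.filter_true_of_mem fun q hq => ?_
    by_cases h0 : key₁ q = 0
    · refine Or.inr ⟨h0, not_le.1 fun hle => ?_⟩
      exact hptr.ne q (Finset.mem_range.1 hq) hle h0
    · exact Or.inl (Nat.pos_of_ne_zero h0)
  refine ⟨Nat.zero_le _, hptr.le, hptr.eq, ?_, ?_, ?_, ?_, .zero hhead, ?_⟩
  · intro e he; omega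
  · intro e he; omega
  · intro e e' _ he; omega
  · intro q hq hq'
    rw [hall] at hq'
    exact absurd (Finset.mem_range.2 hq) hq'
  · rw [hall, Finset.card_range, Nat.zero_add]

theorem edge (h : IsEmptying n A N kf m src key₁ d p E val key nxt head)
    (hB : IsBuckets n A N kf m src key₁ nxt₁ head₁) (hp : p ≠ 0) :
    IsEmptying n A N kf m src key₁ d (nxt₁ (p - 1)) (E + 1)
      (Function.update val E (src (p - 1))) (Function.update key E (N (p - 1)))
      (Function.update nxt E (head (N (p - 1)))) (Function.update head (N (p - 1)) (E + 1)) ∧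
    (todoBuckets key₁ m d (nxt₁ (p - 1))).card < (todoBuckets key₁ m d p).card := by
  have hpm := h.p_le
  have hp₁ : p - 1 < m := by omega
  have hkey := h.key_ptr hp
  have hptr := hB.linked.nxt (p - 1) hp₁
  rw [hkey] at hptr
  have hptrle := hptr.le
  have hmem : p - 1 ∈ todoBuckets key₁ m d p :=
    Finset.mem_filter.2 ⟨Finset.mem_range.2 hp₁, Or.inr ⟨hkey, by omega⟩⟩
  have herase : todoBuckets key₁ m d (nxt₁ (p - 1)) = (todoBuckets key₁ m d p).erase (p - 1) := by
    ext q
    simp only [todoBuckets, Finset.mem_filter, Finset.mem_range, Finset.mem_erase]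
    constructor
    · rintro ⟨hq, hq' | ⟨hq₁, hq₂⟩⟩
      · exact ⟨fun h => by rw [h] at hq'; omega, hq, Or.inl hq'⟩
      · exact ⟨by omega, hq, Or.inr ⟨hq₁, by omega⟩⟩
    · rintro ⟨hne, hq, hq' | ⟨hq₁, hq₂⟩⟩
      · exact ⟨hq, Or.inl hq'⟩
      · refine ⟨hq, Or.inr ⟨hq₁, not_le.1 fun hle => ?_⟩⟩
        exact hptr.ne q (by omega) hle hq₁
  have hcard := Finset.card_erase_add_one hmem
  have hval : ∀ e < E, Function.update val E (src (p - 1)) e = val e := fun e he =>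
    Function.update_of_ne (by omega) _ _
  have hkey' : ∀ e < E, Function.update key E (N (p - 1)) e = key e := fun e he =>
    Function.update_of_ne (by omega) _ _
  have hkd : kf (src (p - 1)) = d := by rw [← hB.key_eq _ hp₁, hkey]
  refine ⟨⟨h.d_le, by omega, hptr.eq, ?_, ?_, ?_, ?_, h.linked.push _, ?_⟩, ?_⟩
  · intro e he
    rcases Nat.lt_succ_iff_lt_or_eq.1 he with he | rfl
    · rw [hval e he, hkey' e he]
      exact h.adj e he
    · rw [Function.update_self, Function.update_self]
      exact hB.adj _ hp₁
  · intro e he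
    rcases Nat.lt_succ_iff_lt_or_eq.1 he with he | rfl
    · rw [hval e he]
      exact h.kf_le e he
    · rw [Function.update_self, hkd]
  · intro e e' hee' he'
    rcases Nat.lt_succ_iff_lt_or_eq.1 he' with he' | rfl
    · rw [hval e (by omega), hval e' he']
      exact h.sorted e e' hee' he'
    · rcases hee'.lt_or_eq with hlt | rfl
      · rw [hval e hlt, Function.update_self, hkd]
        exact h.kf_le e hlt
      · exact le_rfl
  · intro q hq hq'
    rw [herase, Finset.mem_erase, not_and_or, not_not] at hq'
    by_cases hqp : q = p - 1
    · refine ⟨E, Nat.lt_succ_self E, ?_, ?_⟩ <;> rw [Function.update_self, hqp]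
    · obtain ⟨e, he, h₁, h₂⟩ := h.exists_of_notMem q hq (hq'.resolve_left hqp)
      refine ⟨e, by omega, ?_, ?_⟩
      · rw [hval e he, h₁]
      · rw [hkey' e he, h₂]
  · have := h.card
    rw [herase]
    omega
  · rw [herase]
    omega

theorem next (h : IsEmptying n A N kf m src key₁ d p E val key nxt head)
    (hB : IsBuckets n A N kf m src key₁ nxt₁ head₁) (hd : d < n + 1) (hp : p = 0) :
    IsEmptying n A N kf m src key₁ (d + 1) (head₁ (d + 1)) E val key nxt head ∧
    (todoBuckets key₁ m (d + 1) (head₁ (d + 1))).card = (todoBuckets key₁ m d p).card := by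
  have hptr := hB.linked.head (d + 1)
  have heq : todoBuckets key₁ m (d + 1) (head₁ (d + 1)) = todoBuckets key₁ m d p := by
    ext q
    simp only [todoBuckets, Finset.mem_filter, Finset.mem_range]
    refine and_congr_right fun hq => ?_
    constructor
    · rintro (hq' | ⟨hq₁, hq₂⟩) <;> left <;> omega
    · rintro (hq' | ⟨hq₁, hq₂⟩)
      · rcases (Nat.succ_le_of_lt hq').lt_or_eq with hlt | heq
        · exact Or.inl hlt
        · exact Or.inr ⟨heq.symm, not_le.1 fun hle => hptr.ne q hq hle heq.symm⟩
      · omega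
  refine ⟨⟨hd, hptr.le, hptr.eq, h.adj, fun e he => (h.kf_le e he).trans (Nat.le_succ d),
    h.sorted, ?_, h.linked, ?_⟩, by rw [heq]⟩
  · rw [heq]
    exact h.exists_of_notMem
  · rw [heq]
    exact h.card

theorem isSorted (h : IsEmptying n A N kf m src key₁ d p E val key nxt head)
    (hB : IsBuckets n A N kf m src key₁ nxt₁ head₁) (hlt : ∀ u v, A u v → u < n)
    (hkf : ∀ v < n, kf v ≤ n) (hd : ¬ d < n + 1) :
    IsSorted n A kf E val key nxt head ∧ E ≤ m := by
  refine ⟨⟨h.adj, fun u v huv => ?_, h.sorted, h.linked⟩, by have := h.card; omega⟩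
  obtain ⟨q, hq, rfl, rfl⟩ := hB.exists_of_adj u v huv
  refine h.exists_of_notMem q hq fun hmem => ?_
  have h₁ := hB.key_eq q hq
  have h₂ := hkf _ (hlt _ _ huv)
  rcases (Finset.mem_filter.1 hmem).2 with h₃ | ⟨h₃, -⟩ <;> omega

end IsEmptying

/-! ### The breadth-first search on the machine -/

/-- The result of a breadth-first search that takes the roots from `C`, starting with the last
entry: `Q i` is the vertex at position `i`, `L i` is the first position in its closed
neighbourhood, and `R i` is the number of vertices discovered once the vertex at position `i` has
been dealt with. -/
structure IsSearch (n : ℕ) (A : ℕ → ℕ → Prop) (kf C Q L R : ℕ → ℕ) : Prop where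
  Q_lt : ∀ i < n, Q i < n
  Q_inj : ∀ i j, i < j → j < n → Q i ≠ Q j
  L_le : ∀ i < n, L i ≤ i
  adj_L : ∀ i < n, L i < i → A (Q (L i)) (Q i)
  L_le_of_adj : ∀ i < n, ∀ j < n, A (Q j) (Q i) → L i ≤ j
  L_mono : ∀ i j, i ≤ j → j < n → L i ≤ L j
  siblings : ∀ i j, i < j → j < n → L i = L j → L i < i → kf (Q j) ≤ kf (Q i)
  root : ∀ i < n, L i = i → ∃ c < n, C c = Q i ∧ ∀ c', c < c' → c' < n → ∃ j < i, Q j = C c'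
  R_le : ∀ i < n, R i ≤ n
  lt_R_iff : ∀ i < n, ∀ j < n, j < R i ↔ L j ≤ i

/-- The list cells that are still to be visited when the vertices at positions smaller than `h`,
and the cells of the vertex at position `h` from `p` on, have been dealt with. -/
def todoCells (key Q : ℕ → ℕ) (E h t p : ℕ) : Finset ℕ :=
  (Finset.range E).filter fun e => (∀ i < h, key e ≠ Q i) ∧ (h < t → key e = Q h → e < p)

/-- The invariant of the search: `h` is the position of the vertex that is being dealt with, `t`
is the number of vertices discovered, `p` points to the next cell of the list of the vertex at
position `h`, the entries of `C` from `c` on have been discovered, and `vis` marks the vertices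
discovered. -/
structure IsSearching (n : ℕ) (A : ℕ → ℕ → Prop) (kf C : ℕ → ℕ) (E : ℕ) (val key : ℕ → ℕ)
    (h t p c : ℕ) (Q L R vis : ℕ → ℕ) : Prop where
  h_le : h ≤ t
  c_le : c ≤ n
  p_le : h < t → p ≤ E
  key_ptr : h < t → p ≠ 0 → key (p - 1) = Q h
  Q_lt : ∀ i < t, Q i < n
  Q_inj : ∀ i j, i < j → j < t → Q i ≠ Q j
  vis_iff : ∀ v < n, vis v ≠ 0 ↔ ∃ i < t, Q i = v
  vis_of_adj : ∀ i < h, ∀ v, A (Q i) v → vis v ≠ 0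
  vis_of_cell : h < t → ∀ e < E, p ≤ e → key e = Q h → vis (val e) ≠ 0
  vis_of_C : ∀ c', c ≤ c' → c' < n → vis (C c') ≠ 0
  L_le : ∀ i < t, L i ≤ i
  adj_L : ∀ i < t, L i < i → A (Q (L i)) (Q i)
  L_le_of_adj : ∀ i < t, ∀ j < t, A (Q j) (Q i) → L i ≤ j
  L_mono : ∀ i j, i ≤ j → j < t → L i ≤ L j
  L_le_h : ∀ i < t, L i ≤ h
  siblings : ∀ i j, i < j → j < t → L i = L j → L i < i → kf (Q j) ≤ kf (Q i)
  exists_cell : ∀ i < t, L i = h → h < i → ∃ e < E, p ≤ e ∧ val e = Q i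
  root : ∀ i < t, L i = i → ∃ c < n, C c = Q i ∧ ∀ c', c < c' → c' < n → ∃ j < i, Q j = C c'
  R_le : ∀ i < h, R i ≤ t
  lt_R_iff : ∀ i < h, ∀ j < t, j < R i ↔ L j ≤ i

theorem card_le_of_injective_lt {n t : ℕ} {Q : ℕ → ℕ} (hlt : ∀ i < t, Q i < n)
    (hinj : ∀ i j, i < j → j < t → Q i ≠ Q j) : t ≤ n := by
  have := Finset.card_le_card_of_injOn (s := Finset.range t) (t := Finset.range n) Q
    (fun i hi => by simpa using hlt i (by simpa using hi)) ?_
  · simpa using this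
  · intro i hi j hj hij
    simp only [Finset.coe_range, Set.mem_Iio] at hi hj
    rcases lt_trichotomy i j with h | h | h
    · exact absurd hij (hinj i j h hj)
    · exact h
    · exact absurd hij.symm (hinj j i h hi)

namespace IsSearching

variable {n : ℕ} {A : ℕ → ℕ → Prop} {kf C : ℕ → ℕ} {E : ℕ} {val key nxt head : ℕ → ℕ}
  {h t p c : ℕ} {Q L R vis : ℕ → ℕ}

theorem t_le (H : IsSearching n A kf C E val key h t p c Q L R vis) : t ≤ n :=
  card_le_of_injective_lt H.Q_lt H.Q_inj

theorem init (hvis : ∀ v, vis v = 0) : IsSearching n A kf C E val key 0 0 p n Q L R vis := by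
  constructor <;> first | omega | (intros; omega) | skip
  intro v _
  simp [hvis]

/-- Marking a new vertex `w` as the one at position `t`, with `h` the first position in its closed
neighbourhood. -/
theorem discover (H : IsSearching n A kf C E val key h t p c Q L R vis)
    {w p' c' : ℕ} (hw : w < n) (hvis : vis w = 0) (hc' : c' ≤ c) (hp'E : p' ≤ E)
    (hp'key : p' ≠ 0 → key (p' - 1) = Function.update Q t w h)
    (hwA : h < t → A (Q h) w)
    (hcell : ∀ e < E, p' ≤ e → key e = Function.update Q t w h → vis (val e) = 0 → val e = w)
    (hC : ∀ i, c' ≤ i → i < n → vis (C i) = 0 → C i = w)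
    (hp' : h < t → p' ≤ p) (hsib : h < t → ∀ e < E, p ≤ e → kf w ≤ kf (val e))
    (hex : h < t → ∃ e < E, p' ≤ e ∧ val e = w)
    (hroot : ¬ h < t → ∃ i < n, C i = w ∧ ∀ j, i < j → j < n → ∃ k < t, Q k = C j) :
    IsSearching n A kf C E val key h (t + 1) p' c' (Function.update Q t w)
      (Function.update L t h) R (Function.update vis w 1) := by
  have hQ : ∀ i < t, Function.update Q t w i = Q i := fun i hi =>
    Function.update_of_ne (by omega) _ _
  have hL : ∀ i < t, Function.update L t h i = L i := fun i hi =>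
    Function.update_of_ne (by omega) _ _
  have hQt : Function.update Q t w t = w := Function.update_self _ _ _
  have hLt : Function.update L t h t = h := Function.update_self _ _ _
  have hht := H.h_le
  have hnew : ∀ i < t, Q i ≠ w := fun i hi heq => (H.vis_iff w hw).2 ⟨i, hi, heq⟩ hvis
  have hmark : ∀ v, vis v ≠ 0 → Function.update vis w 1 v ≠ 0 := by
    intro v hv
    rw [Function.update_apply]
    split_ifs
    exacts [one_ne_zero, hv]
  have hmark' : ∀ v, (vis v = 0 → v = w) → Function.update vis w 1 v ≠ 0 := by
    intro v hv
    by_cases h0 : vis v = 0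
    · rw [hv h0, Function.update_self]
      exact one_ne_zero
    · exact hmark v h0
  have hcases : ∀ {i}, i < t + 1 → i < t ∨ i = t := fun hi => Nat.lt_succ_iff_lt_or_eq.1 hi
  constructor
  case h_le => omega
  case c_le => exact hc'.trans H.c_le
  case p_le => exact fun _ => hp'E
  case key_ptr => exact fun _ => hp'key
  case Q_lt =>
    intro i hi
    rcases hcases hi with hi | rfl
    · rw [hQ i hi]; exact H.Q_lt i hi
    · rwa [hQt]
  case Q_inj =>
    intro i j hij hj
    rcases hcases hj with hj | rfl
    · rw [hQ i (by omega), hQ j hj]; exact H.Q_inj i j hij hj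
    · rw [hQ i hij, hQt]; exact hnew i hij
  case vis_iff =>
    intro v hv
    by_cases hvw : v = w
    · subst hvw
      rw [Function.update_self]
      exact iff_of_true one_ne_zero ⟨t, Nat.lt_succ_self t, hQt⟩
    · rw [Function.update_of_ne hvw, H.vis_iff v hv]
      constructor
      · rintro ⟨i, hi, hiv⟩
        exact ⟨i, by omega, by rw [hQ i hi, hiv]⟩
      · rintro ⟨i, hi, hiv⟩
        rcases hcases hi with hi | rfl
        · exact ⟨i, hi, by rw [← hQ i hi, hiv]⟩
        · exact absurd (hQt ▸ hiv).symm hvw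
  case vis_of_adj =>
    intro i hi v hv
    rw [hQ i (by omega)] at hv
    exact hmark v (H.vis_of_adj i hi v hv)
  case vis_of_cell =>
    intro _ e he hpe hke
    exact hmark' _ (hcell e he hpe hke)
  case vis_of_C => exact fun i hi hin => hmark' _ (hC i hi hin)
  case L_le =>
    intro i hi
    rcases hcases hi with hi | rfl
    · rw [hL i hi]; exact H.L_le i hi
    · rwa [hLt]
  case adj_L =>
    intro i hi hLi
    rcases hcases hi with hi | rfl
    · rw [hL i hi] at hLi ⊢
      rw [hQ _ (by omega), hQ i hi]
      exact H.adj_L i hi hLi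
    · rw [hLt] at hLi ⊢
      rw [hQ _ hLi, hQt]
      exact hwA hLi
  case L_le_of_adj =>
    intro i hi j hj hA
    rcases hcases hi with hi | rfl
    · rw [hL i hi]
      rcases hcases hj with hj | rfl
      · rw [hQ i hi, hQ j hj] at hA
        exact H.L_le_of_adj i hi j hj hA
      · exact (H.L_le i hi).trans hi.le
    · rw [hLt]
      rcases hcases hj with hj | rfl
      · rw [hQt, hQ j hj] at hA
        by_contra! hlt
        exact H.vis_of_adj j hlt w hA hvis
      · exact hht
  case L_mono =>
    intro i j hij hj
    rcases hcases hj with hj | rfl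
    · rw [hL i (by omega), hL j hj]; exact H.L_mono i j hij hj
    · rcases hij.lt_or_eq with hij | rfl
      · rw [hL i hij, hLt]; exact H.L_le_h i hij
      · exact le_rfl
  case L_le_h =>
    intro i hi
    rcases hcases hi with hi | rfl
    · rw [hL i hi]; exact H.L_le_h i hi
    · rw [hLt]
  case siblings =>
    intro i j hij hj hLij hLi
    rcases hcases hj with hj | rfl
    · rw [hL i (by omega)] at hLij hLi
      rw [hL j hj] at hLij
      rw [hQ i (by omega), hQ j hj]
      exact H.siblings i j hij hj hLij hLi
    · rw [hL i hij] at hLij hLi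
      rw [hLt] at hLij
      rw [hQ i hij, hQt]
      obtain ⟨e, he, hpe, hve⟩ := H.exists_cell i hij hLij (by omega)
      rw [← hve]
      exact hsib (by omega) e he hpe
  case exists_cell =>
    intro i hi hLi hlt
    rcases hcases hi with hi | rfl
    · rw [hL i hi] at hLi
      obtain ⟨e, he, hpe, hve⟩ := H.exists_cell i hi hLi hlt
      exact ⟨e, he, (hp' (by omega)).trans hpe, by rw [hQ i hi, hve]⟩
    · obtain ⟨e, he, hpe, hve⟩ := hex hlt
      exact ⟨e, he, hpe, by rw [hQt, hve]⟩
  case root =>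
    intro i hi hLi
    rcases hcases hi with hi | rfl
    · rw [hL i hi] at hLi
      obtain ⟨c₀, hc₀, hCc, hc₁⟩ := H.root i hi hLi
      refine ⟨c₀, hc₀, by rw [hQ i hi, hCc], fun j hj hjn => ?_⟩
      obtain ⟨k, hk, hkC⟩ := hc₁ j hj hjn
      exact ⟨k, hk, by rw [hQ k (by omega), hkC]⟩
    · rw [hLt] at hLi
      obtain ⟨c₀, hc₀, hCc, hc₁⟩ := hroot (by omega)
      refine ⟨c₀, hc₀, by rw [hQt, hCc], fun j hj hjn => ?_⟩
      obtain ⟨k, hk, hkC⟩ := hc₁ j hj hjn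
      exact ⟨k, hk, by rw [hQ k hk, hkC]⟩
  case R_le => exact fun i hi => (H.R_le i hi).trans (Nat.le_succ t)
  case lt_R_iff =>
    intro i hi j hj
    rcases hcases hj with hj | rfl
    · rw [hL j hj]; exact H.lt_R_iff i hi j hj
    · rw [hLt]
      have := H.R_le i hi
      omega

/-- The next cell of the list of the vertex at position `h` holds a vertex that has not been
discovered before. -/
theorem cell_new (H : IsSearching n A kf C E val key h t p c Q L R vis)
    (hS : IsSorted n A kf E val key nxt head) (hsymm : ∀ u v, A u v → A v u)
    (hlt : ∀ u v, A u v → u < n) (hht : h < t) (hp : p ≠ 0) (hvis : vis (val (p - 1)) = 0) :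
    IsSearching n A kf C E val key h (t + 1) (nxt (p - 1)) c (Function.update Q t (val (p - 1)))
      (Function.update L t h) R (Function.update vis (val (p - 1)) 1) := by
  have hpE := H.p_le hht
  have hkey := H.key_ptr hht hp
  have hptr := hS.linked.nxt (p - 1) (by omega)
  have hptrle := hptr.le
  have hA := hS.adj (p - 1) (by omega)
  rw [hkey] at hptr hA
  have hQ : Function.update Q t (val (p - 1)) h = Q h := Function.update_of_ne hht.ne _ _
  refine H.discover (hlt _ _ hA) hvis le_rfl (by omega) (fun h0 => ?_)
    (fun _ => hsymm _ _ hA) (fun e he hpe hke hve => ?_)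
    (fun i hi hin hv => absurd hv (H.vis_of_C i hi hin)) (fun _ => by omega)
    (fun _ e he hpe => hS.sorted _ _ (by omega) he)
    (fun _ => ⟨p - 1, by omega, hptrle, rfl⟩) (fun h => absurd hht h)
  · rw [hQ]
    exact hptr.eq h0
  · rw [hQ] at hke
    rcases lt_trichotomy e (p - 1) with hlt | rfl | hgt
    · exact absurd hke (hptr.ne e hlt hpe)
    · rfl
    · exact absurd hve (H.vis_of_cell hht e he (by omega) hke)

/-- The next cell of the list of the vertex at position `h` holds a vertex that has been
discovered before. -/
theorem cell_old (H : IsSearching n A kf C E val key h t p c Q L R vis)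
    (hS : IsSorted n A kf E val key nxt head) (hht : h < t) (hp : p ≠ 0)
    (hvis : vis (val (p - 1)) ≠ 0) :
    IsSearching n A kf C E val key h t (nxt (p - 1)) c Q L R vis := by
  have hpE := H.p_le hht
  have hptr := hS.linked.nxt (p - 1) (by omega)
  have hptrle := hptr.le
  rw [H.key_ptr hht hp] at hptr
  refine { H with
    p_le := fun _ => by omega
    key_ptr := fun _ => hptr.eq
    vis_of_cell := fun _ e he hpe hke => ?_
    exists_cell := fun i hi hLi hlt => ?_ }
  · rcases lt_trichotomy e (p - 1) with hlt | rfl | hgt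
    · exact absurd hke (hptr.ne e hlt hpe)
    · exact hvis
    · exact H.vis_of_cell hht e he (by omega) hke
  · obtain ⟨e, he, hpe, hve⟩ := H.exists_cell i hi hLi hlt
    exact ⟨e, he, by omega, hve⟩

/-- The list of the vertex at position `h` has been finished. -/
theorem finish (H : IsSearching n A kf C E val key h t p c Q L R vis)
    (hS : IsSorted n A kf E val key nxt head) (hsymm : ∀ u v, A u v → A v u) (hht : h < t)
    (hp : p = 0) :
    IsSearching n A kf C E val key (h + 1) t (head (Q (h + 1))) c Q L (Function.update R h t)
      vis := by
  have hptr := hS.linked.head (Q (h + 1))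
  refine { H with
    h_le := hht
    p_le := fun _ => hptr.le
    key_ptr := fun _ => hptr.eq
    vis_of_adj := fun i hi v hv => ?_
    vis_of_cell := fun _ e he hpe hke => absurd hke (hptr.ne e he hpe)
    L_le_h := fun i hi => (H.L_le_h i hi).trans (Nat.le_succ h)
    exists_cell := fun i hi hLi _ => ?_
    R_le := fun i hi => ?_
    lt_R_iff := fun i hi j hj => ?_ }
  · rcases Nat.lt_succ_iff_lt_or_eq.1 hi with hi | rfl
    · exact H.vis_of_adj i hi v hv
    · obtain ⟨e, he, rfl, hke⟩ := hS.exists_of_adj v (Q i) (hsymm _ _ hv)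
      exact H.vis_of_cell hht e he (by omega) hke
  · have := H.L_le_h i hi
    omega
  · rcases Nat.lt_succ_iff_lt_or_eq.1 hi with hi | rfl
    · rw [Function.update_of_ne (by omega)]
      exact H.R_le i hi
    · rw [Function.update_self]
  · rcases Nat.lt_succ_iff_lt_or_eq.1 hi with hi | rfl
    · rw [Function.update_of_ne (by omega)]
      exact H.lt_R_iff i hi j hj
    · rw [Function.update_self]
      exact iff_of_true hj (H.L_le_h j hj)

/-- All lists are finished, and the next entry of `C` is the root of another component. -/
theorem root_new (H : IsSearching n A kf C E val key h t p c Q L R vis)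
    (hS : IsSorted n A kf E val key nxt head) (hC : ∀ i < n, C i < n) (hht : ¬ h < t) (hc : 0 < c)
    (hvis : vis (C (c - 1)) = 0) :
    IsSearching n A kf C E val key h (t + 1) (head (C (c - 1))) (c - 1)
      (Function.update Q t (C (c - 1))) (Function.update L t t) R
      (Function.update vis (C (c - 1)) 1) := by
  obtain rfl : h = t := le_antisymm H.h_le (not_lt.1 hht)
  have hcn := H.c_le
  have hptr := hS.linked.head (C (c - 1))
  refine H.discover (hC _ (by omega)) hvis (Nat.sub_le c 1) hptr.le (fun h0 => ?_)
    (fun h => absurd h hht) (fun e he hpe hke => ?_) (fun i hi hin hv => ?_)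
    (fun h => absurd h hht) (fun h => absurd h hht) (fun h => absurd h hht)
    (fun _ => ⟨c - 1, by omega, rfl, fun j hj hjn => ?_⟩)
  · rw [Function.update_self]
    exact hptr.eq h0
  · rw [Function.update_self] at hke
    exact absurd hke (hptr.ne e he hpe)
  · rcases hi.eq_or_lt with rfl | hlt
    · rfl
    · exact absurd hv (H.vis_of_C i (by omega) hin)
  · exact (H.vis_iff _ (hC j hjn)).1 (H.vis_of_C j (by omega) hjn)

theorem root_old (H : IsSearching n A kf C E val key h t p c Q L R vis)
    (hvis : vis (C (c - 1)) ≠ 0) :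
    IsSearching n A kf C E val key h t p (c - 1) Q L R vis := by
  refine { H with
    c_le := (Nat.sub_le c 1).trans H.c_le
    vis_of_C := fun i hi hin => ?_ }
  by_cases h0 : i = c - 1
  · rwa [h0]
  · exact H.vis_of_C i (by omega) hin

theorem isSearch (H : IsSearching n A kf C E val key h t p c Q L R vis)
    (hC : ∀ v < n, ∃ i < n, C i = v) (hht : h = t) (hc : c = 0) :
    IsSearch n A kf C Q L R := by
  subst hht hc
  have htn : h = n := by
    refine le_antisymm H.t_le ?_
    have hall : ∀ v < n, ∃ i < h, Q i = v := fun v hv => by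
      obtain ⟨i, hi, rfl⟩ := hC v hv
      exact (H.vis_iff _ hv).1 (H.vis_of_C i (Nat.zero_le i) hi)
    have := Finset.card_le_card (s := Finset.range n) (t := (Finset.range h).image Q)
      (fun v hv => by simpa using hall v (by simpa using hv))
    simpa using this.trans Finset.card_image_le
  subst htn
  exact ⟨H.Q_lt, H.Q_inj, H.L_le, H.adj_L, H.L_le_of_adj, H.L_mono, H.siblings, H.root, H.R_le,
    H.lt_R_iff⟩

end IsSearching

theorem card_todoCells_lt {key Q Q' : ℕ → ℕ} {E h t t' p p' : ℕ} (ht' : h < t')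
    (hQ : ∀ i ≤ h, Q' i = Q i) (hinj : ∀ i < h, Q i ≠ Q h) (hp : p ≠ 0) (hpE : p ≤ E)
    (hkey : key (p - 1) = Q h) (hp' : p' ≤ p - 1) :
    (todoCells key Q' E h t' p').card < (todoCells key Q E h t p).card := by
  refine Finset.card_lt_card (Finset.ssubset_iff_of_subset ?_ |>.2 ⟨p - 1, ?_, ?_⟩)
  · intro e he
    simp only [todoCells, Finset.mem_filter] at he ⊢
    refine ⟨he.1, fun i hi => hQ i hi.le ▸ he.2.1 i hi, fun _ hke => ?_⟩
    have := he.2.2 ht' (hke.trans (hQ h le_rfl).symm)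
    omega
  · simp only [todoCells, Finset.mem_filter, Finset.mem_range]
    refine ⟨by omega, fun i hi heq => hinj i hi (heq.symm.trans hkey), fun _ _ => by omega⟩
  · simp only [todoCells, Finset.mem_filter, Finset.mem_range, not_and]
    intro _ _ hlt
    have := hlt ht' (hkey.trans (hQ h le_rfl).symm)
    omega

theorem card_todoCells_finish_le {key Q : ℕ → ℕ} {E h t p p' : ℕ} :
    (todoCells key Q E (h + 1) t p').card ≤ (todoCells key Q E h t p).card := by
  refine Finset.card_le_card fun e he => ?_
  simp only [todoCells, Finset.mem_filter] at he ⊢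
  exact ⟨he.1, fun i hi => he.2.1 i (by omega),
    fun _ hke => absurd hke (he.2.1 h (Nat.lt_succ_self h))⟩

theorem card_todoCells_root_le {key Q Q' : ℕ → ℕ} {E h t t' p p' : ℕ} (ht : ¬ h < t)
    (hQ : ∀ i < h, Q' i = Q i) :
    (todoCells key Q' E h t' p').card ≤ (todoCells key Q E h t p).card := by
  refine Finset.card_le_card fun e he => ?_
  simp only [todoCells, Finset.mem_filter] at he ⊢
  exact ⟨he.1, fun i hi => hQ i hi ▸ he.2.1 i hi, fun h => absurd h ht⟩

namespace State

@[simp] theorem setReg_reg (s : State) (x v y : ℕ) :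
    (s.setReg x v).reg y = if y = x then v else s.reg y := by
  simp [setReg, Function.update_apply]

@[simp] theorem setReg_arr (s : State) (x v : ℕ) : (s.setReg x v).arr = s.arr := rfl

@[simp] theorem setArr_reg (s : State) (a i v : ℕ) : (s.setArr a i v).reg = s.reg := rfl

@[simp] theorem setArr_arr (s : State) (a i v b : ℕ) :
    (s.setArr a i v).arr b = if b = a then Function.update (s.arr a) i v else s.arr b := by
  simp only [setArr, Function.update_apply]

end State

theorem Prog.LoopFree.final_arr {p : Prog} (hp : p.LoopFree) {a : ℕ} (ha : ¬ p.SetsArr a)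
    (s : State) : (p.final s).arr a = s.arr a :=
  (hp.reaches s).arr_eq ha

theorem Prog.LoopFree.final_reg {p : Prog} (hp : p.LoopFree) {x : ℕ} (hx : ¬ p.SetsReg x)
    (s : State) : (p.final s).reg x = s.reg x :=
  (hp.reaches s).reg_eq hx

/-! ### The program of a search -/

local infixr:50 " ;; " => Prog.seq

open Prog

/-- One round of the loop that distributes the edges over the buckets.  Register `2` holds the
current vertex, register `3` the next edge, and `key` computes the key of the current vertex. -/
def fillBody (b : ℕ) (key : Expr) : Prog :=
  .ite (.lt (.reg 3) (.get 0 (.add (.reg 2) (.const 1))))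
    (.assign 8 key ;;
     .store (b + 4) (.reg 3) (.reg 2) ;;
     .store (b + 5) (.reg 3) (.reg 8) ;;
     .store (b + 6) (.reg 3) (.get (b + 7) (.reg 8)) ;;
     .store (b + 7) (.reg 8) (.add (.reg 3) (.const 1)) ;;
     .assign 3 (.add (.reg 3) (.const 1)))
    (.assign 2 (.add (.reg 2) (.const 1)))

/-- One round of the loop that moves the edges from the buckets to the lists of their targets.
Register `2` holds the current bucket, register `3` points into it, and register `4` holds the
number of edges moved. -/
def emptyBody (b : ℕ) : Prog :=
  .ite (.reg 3)
    (.assign 3 (.sub (.reg 3) (.const 1)) ;;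
     .assign 8 (.get 1 (.reg 3)) ;;
     .store (b + 8) (.reg 4) (.get (b + 4) (.reg 3)) ;;
     .store (b + 9) (.reg 4) (.reg 8) ;;
     .store (b + 10) (.reg 4) (.get (b + 11) (.reg 8)) ;;
     .assign 4 (.add (.reg 4) (.const 1)) ;;
     .store (b + 11) (.reg 8) (.reg 4) ;;
     .assign 3 (.get (b + 6) (.reg 3)))
    (.assign 2 (.add (.reg 2) (.const 1)) ;;
     .assign 3 (.get (b + 7) (.reg 2)))

/-- One round of the breadth-first search.  Register `5` holds the position of the current vertex,
register `7` the number of vertices discovered, register `3` points into the list of the current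
vertex, register `6` holds the number of candidates for a root that are left, and `cand` computes
the next candidate. -/
def searchBody (b : ℕ) (cand : Expr) : Prog :=
  .ite (.lt (.reg 5) (.reg 7))
    (.ite (.reg 3)
      (.assign 3 (.sub (.reg 3) (.const 1)) ;;
       .assign 8 (.get (b + 8) (.reg 3)) ;;
       .assign 3 (.get (b + 10) (.reg 3)) ;;
       .ite (.get (b + 15) (.reg 8)) .skip
         (.store (b + 15) (.reg 8) (.const 1) ;;
          .store (b + 12) (.reg 7) (.reg 8) ;;
          .store (b + 13) (.reg 7) (.reg 5) ;;
          .assign 7 (.add (.reg 7) (.const 1))))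
      (.store (b + 14) (.reg 5) (.reg 7) ;;
       .assign 5 (.add (.reg 5) (.const 1)) ;;
       .assign 3 (.get (b + 11) (.get (b + 12) (.reg 5)))))
    (.assign 6 (.sub (.reg 6) (.const 1)) ;;
     .assign 8 cand ;;
     .ite (.get (b + 15) (.reg 8)) .skip
       (.store (b + 15) (.reg 8) (.const 1) ;;
        .store (b + 12) (.reg 7) (.reg 8) ;;
        .store (b + 13) (.reg 7) (.reg 7) ;;
        .assign 7 (.add (.reg 7) (.const 1)) ;;
        .assign 3 (.get (b + 11) (.reg 8))))

/-- There are vertices left. -/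
def fillCond : Expr := .lt (.reg 2) (.reg 0)

/-- There are buckets left; the keys may have any value from `0` to `n`. -/
def emptyCond : Expr := .lt (.reg 2) (.add (.reg 0) (.const 1))

/-- Not all vertices discovered have been dealt with, or there are candidates left. -/
def searchCond : Expr :=
  .sub (.const 1) (.sub (.eq (.reg 5) (.reg 7)) (.lt (.const 0) (.reg 6)))

/-- A breadth-first search that visits siblings by descending values of `key` and takes the roots
from the values of `cand`.  The arrays `b + 4` to `b + 7` hold the sources, the keys, the links and
the heads of the buckets, the arrays `b + 8` to `b + 11` the neighbours, the keys, the links and the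
heads of the sorted lists; the result of the search is in the arrays `b + 12`, `b + 13` and
`b + 14`, and the array `b + 15` marks the vertices discovered. -/
def sweep (b : ℕ) (key cand : Expr) : Prog :=
  .assign 2 (.const 0) ;; .assign 3 (.const 0) ;; .loop fillCond (fillBody b key) ;;
  .assign 2 (.const 0) ;; .assign 3 (.get (b + 7) (.const 0)) ;; .assign 4 (.const 0) ;;
  .loop emptyCond (emptyBody b) ;;
  .assign 5 (.const 0) ;; .assign 6 (.reg 0) ;; .assign 7 (.const 0) ;;
  .loop searchCond (searchBody b cand)

theorem fillBody_loopFree (b : ℕ) (key : Expr) : (fillBody b key).LoopFree := by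
  simp [fillBody, LoopFree]

theorem emptyBody_loopFree (b : ℕ) : (emptyBody b).LoopFree := by
  simp [emptyBody, LoopFree]

theorem searchBody_loopFree (b : ℕ) (cand : Expr) : (searchBody b cand).LoopFree := by
  simp [searchBody, LoopFree]

theorem searchCond_ne_zero (s : State) :
    searchCond.eval s ≠ 0 ↔ ¬ (s.reg 5 = s.reg 7 ∧ s.reg 6 = 0) := by
  by_cases h₁ : s.reg 5 = s.reg 7 <;> by_cases h₂ : s.reg 6 = 0 <;>
    simp [searchCond, Expr.eval, h₁, h₂, Nat.pos_iff_ne_zero]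

/-- The first loop fills the buckets in linear time.  The factor `K` depends on the program only. -/
theorem exists_reaches_fill (b : ℕ) (key : Expr) : ∃ K, ∀ {n A X N kf}, IsInput n A X N →
    (∀ s : State, s.reg 0 = n → s.arr 0 = X → key.eval s = kf (s.reg 2)) →
    ∀ s : State, s.reg 0 = n → s.arr 0 = X → s.reg 2 = 0 → s.reg 3 = 0 →
      (∀ k, s.arr (b + 7) k = 0) →
      ∃ s', Reaches (.loop fillCond (fillBody b key)) s (K * (n + X n + 1)) s' ∧
        IsBuckets n A N kf (X n) (s'.arr (b + 4)) (s'.arr (b + 5)) (s'.arr (b + 6))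
          (s'.arr (b + 7)) := by
  refine ⟨2 * (fillCond.cost + 1 + (fillBody b key).maxTime),
    fun {n A X N kf} hX hkey s h0 hX0 h2 h3 hhead => ?_⟩
  obtain ⟨s', hs', ⟨h0', hX', hI⟩, he⟩ := exists_reaches_loop (fillBody_loopFree b key)
    (e := fillCond)
    (fun s => s.reg 0 = n ∧ s.arr 0 = X ∧ IsFilling n X kf (s.reg 2) (s.reg 3) (s.arr (b + 4))
      (s.arr (b + 5)) (s.arr (b + 6)) (s.arr (b + 7)))
    (fun s => (n - s.reg 2) + (X n - s.reg 3))
    (by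
      rintro s ⟨h0, hX0, hI⟩ he
      have hv : s.reg 2 < n := by simpa [fillCond, Expr.eval, h0] using he
      have hle := hI.p_le
      by_cases hp : s.reg 3 < X (s.reg 2 + 1)
      · have := hX.mono (u := s.reg 2 + 1) hv le_rfl
        simp [fillBody, final, Expr.eval, h0, hX0, hp, hkey s h0 hX0]
        exact ⟨hI.edge hX hv hp, by omega⟩
      · simp [fillBody, final, Expr.eval, h0, hX0, hp]
        exact ⟨hI.next hv hp, by omega⟩)
    s ⟨h0, hX0, by rw [h2, h3]; exact .init hX hhead⟩
  refine ⟨s', hs'.mono ?_, ?_⟩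
  rotate_left
  · refine hI.isBuckets hX ?_
    simpa [fillCond, Expr.eval, h0'] using he
  · rw [mul_right_comm]
    exact Nat.mul_le_mul_right _ (by omega)

/-- The second loop builds the sorted lists in linear time.  An edge leaves the set of edges still
to be visited in every round that does not go on to the next bucket. -/
theorem exists_reaches_empty (b : ℕ) : ∃ K, ∀ {n A X N kf}, IsInput n A X N →
    (∀ v < n, kf v ≤ n) → ∀ s : State, s.reg 0 = n → s.arr 1 = N →
      IsBuckets n A N kf (X n) (s.arr (b + 4)) (s.arr (b + 5)) (s.arr (b + 6)) (s.arr (b + 7)) →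
      s.reg 2 = 0 → s.reg 3 = s.arr (b + 7) 0 → s.reg 4 = 0 → (∀ k, s.arr (b + 11) k = 0) →
      ∃ s', Reaches (.loop emptyCond (emptyBody b)) s (K * (n + X n + 1)) s' ∧
        ∃ E ≤ X n, IsSorted n A kf E (s'.arr (b + 8)) (s'.arr (b + 9)) (s'.arr (b + 10))
          (s'.arr (b + 11)) := by
  refine ⟨2 * (emptyCond.cost + 1 + (emptyBody b).maxTime),
    fun {n A X N kf} hX hkf s h0 hN hB h2 h3 h4 hhead => ?_⟩
  obtain ⟨s', hs', ⟨h0', -, -, -, -, hI⟩, he⟩ := exists_reaches_loop (emptyBody_loopFree b)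
    (e := emptyCond)
    (fun s' => s'.reg 0 = n ∧ s'.arr 1 = N ∧ s'.arr (b + 4) = s.arr (b + 4) ∧
      s'.arr (b + 6) = s.arr (b + 6) ∧ s'.arr (b + 7) = s.arr (b + 7) ∧
      IsEmptying n A N kf (X n) (s.arr (b + 4)) (s.arr (b + 5)) (s'.reg 2) (s'.reg 3) (s'.reg 4)
        (s'.arr (b + 8)) (s'.arr (b + 9)) (s'.arr (b + 10)) (s'.arr (b + 11)))
    (fun s' => (n + 1 - s'.reg 2) + (todoBuckets (s.arr (b + 5)) (X n) (s'.reg 2) (s'.reg 3)).card)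
    (by
      rintro s' ⟨h0, hN, h4, h6, h7, hI⟩ he
      have hd : s'.reg 2 < n + 1 := by simpa [emptyCond, Expr.eval, h0] using he
      by_cases hp : s'.reg 3 = 0
      · obtain ⟨h₁, h₂⟩ := hI.next hB hd hp
        simp [emptyBody, final, Expr.eval, h0, hN, h4, h6, h7, hp]
        rw [hp] at h₂
        exact ⟨h₁, by omega⟩
      · obtain ⟨h₁, h₂⟩ := hI.edge hB hp
        simp [emptyBody, final, Expr.eval, h0, hN, h4, h6, h7, hp]
        exact ⟨h₁, h₂⟩)
    s ⟨h0, hN, rfl, rfl, rfl, by rw [h2, h3, h4]; exact .init hB hhead⟩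
  refine ⟨s', hs'.mono ?_, ?_⟩
  rotate_left
  · obtain ⟨hS, hE⟩ := hI.isSorted hB hX.lt hkf (by simpa [emptyCond, Expr.eval, h0'] using he)
    exact ⟨_, hE, hS⟩
  · have hcard : (todoBuckets (s.arr (b + 5)) (X n) (s.reg 2) (s.reg 3)).card ≤ X n :=
      (Finset.card_filter_le _ _).trans (Finset.card_range _).le
    rw [mul_right_comm]
    exact Nat.mul_le_mul_right _ (by omega)

/-- The third loop carries out the search in linear time.  Every round finishes a vertex, uses up a
candidate, or removes a cell from those still to be visited. -/
theorem exists_reaches_search (b : ℕ) (cand : Expr) : ∃ K, ∀ {n A X N kf C E}, IsInput n A X N →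
    (∀ i < n, C i < n) → (∀ v < n, ∃ i < n, C i = v) → E ≤ X n →
    ∀ s : State, IsSorted n A kf E (s.arr (b + 8)) (s.arr (b + 9)) (s.arr (b + 10))
        (s.arr (b + 11)) →
      (∀ s' : State, (∀ a < b + 4, s'.arr a = s.arr a) → cand.eval s' = C (s'.reg 6)) →
      s.reg 5 = 0 → s.reg 6 = n → s.reg 7 = 0 → (∀ v, s.arr (b + 15) v = 0) →
      ∃ s', Reaches (.loop searchCond (searchBody b cand)) s (K * (n + X n + 1)) s' ∧
        IsSearch n A kf C (s'.arr (b + 12)) (s'.arr (b + 13)) (s'.arr (b + 14)) := by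
  refine ⟨2 * (searchCond.cost + 1 + (searchBody b cand).maxTime),
    fun {n A X N kf C E} hX hC hC' hE s hS hcand h5 h6 h7 hvis => ?_⟩
  obtain ⟨s', hs', ⟨-, -, -, -, -, hI⟩, he⟩ := exists_reaches_loop (searchBody_loopFree b cand)
    (e := searchCond)
    (fun s' => (∀ a < b + 4, s'.arr a = s.arr a) ∧ s'.arr (b + 8) = s.arr (b + 8) ∧
      s'.arr (b + 9) = s.arr (b + 9) ∧ s'.arr (b + 10) = s.arr (b + 10) ∧
      s'.arr (b + 11) = s.arr (b + 11) ∧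
      IsSearching n A kf C E (s.arr (b + 8)) (s.arr (b + 9)) (s'.reg 5) (s'.reg 7) (s'.reg 3)
        (s'.reg 6) (s'.arr (b + 12)) (s'.arr (b + 13)) (s'.arr (b + 14)) (s'.arr (b + 15)))
    (fun s' => (n - s'.reg 5) + s'.reg 6 +
      (todoCells (s.arr (b + 9)) (s'.arr (b + 12)) E (s'.reg 5) (s'.reg 7) (s'.reg 3)).card)
    (by
      rintro s' ⟨hf, h8, h9, h10, h11, hI⟩ he
      have hf' : ∀ a < b + 4, ((searchBody b cand).final s').arr a = s.arr a := fun a ha => by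
        rw [(searchBody_loopFree b cand).final_arr, hf a ha]
        simp [searchBody, SetsArr]
        omega
      refine and_assoc.2 ⟨hf', ?_⟩
      have hcand' : cand.eval (s'.setReg 6 (s'.reg 6 - 1)) = C (s'.reg 6 - 1) := by
        rw [hcand (s'.setReg 6 (s'.reg 6 - 1)) hf]
        simp
      by_cases hht : s'.reg 5 < s'.reg 7
      · have htn := hI.t_le
        by_cases hp : s'.reg 3 = 0
        · have := card_todoCells_finish_le (key := s.arr (b + 9)) (Q := s'.arr (b + 12)) (E := E)
            (h := s'.reg 5) (t := s'.reg 7) (p := s'.reg 3)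
            (p' := s.arr (b + 11) (s'.arr (b + 12) (s'.reg 5 + 1)))
          simp [searchBody, final, Expr.eval, h8, h9, h10, h11, hht, hp]
          rw [hp] at this
          exact ⟨hI.finish hS hX.symm hht hp, by omega⟩
        · have hpE := hI.p_le hht
          have hkey := hI.key_ptr hht hp
          have hptr := (hS.linked.nxt (s'.reg 3 - 1) (by omega)).le
          have hinj : ∀ i < s'.reg 5, s'.arr (b + 12) i ≠ s'.arr (b + 12) (s'.reg 5) :=
            fun i hi => hI.Q_inj i _ hi hht
          by_cases hv : s'.arr (b + 15) (s.arr (b + 8) (s'.reg 3 - 1)) = 0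
          · simp [searchBody, final, Expr.eval, h8, h9, h10, h11, hht, hp, hv]
            refine ⟨hI.cell_new hS hX.symm hX.lt hht hp hv, ?_⟩
            exact card_todoCells_lt (by omega) (fun i hi => Function.update_of_ne (by omega) _ _)
              hinj hp hpE hkey hptr
          · simp [searchBody, final, Expr.eval, h8, h9, h10, h11, hht, hp, hv]
            refine ⟨hI.cell_old hS hht hp hv, ?_⟩
            exact card_todoCells_lt hht (fun _ _ => rfl) hinj hp hpE hkey hptr
      · have hc : 0 < s'.reg 6 := by
          have := hI.h_le
          rw [searchCond_ne_zero] at he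
          omega
        by_cases hv : s'.arr (b + 15) (C (s'.reg 6 - 1)) = 0
        · have := card_todoCells_root_le (key := s.arr (b + 9)) (Q := s'.arr (b + 12))
            (Q' := Function.update (s'.arr (b + 12)) (s'.reg 7) (C (s'.reg 6 - 1))) (E := E)
            (t' := s'.reg 7 + 1) (p := s'.reg 3) (p' := s.arr (b + 11) (C (s'.reg 6 - 1))) hht
            (fun i hi => Function.update_of_ne (by have := hI.h_le; omega) _ _)
          have hroot := hI.root_new hS hC hht hc hv
          simp [searchBody, final, Expr.eval, h8, h9, h10, h11, hht, hcand', hv]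
          exact ⟨hroot, by omega⟩
        · simp [searchBody, final, Expr.eval, h8, h9, h10, h11, hht, hcand', hv]
          exact ⟨hI.root_old hv, by omega⟩)
    s ⟨fun _ _ => rfl, rfl, rfl, rfl, rfl, by rw [h5, h6, h7]; exact .init hvis⟩
  refine ⟨s', hs'.mono ?_, ?_⟩
  rotate_left
  · have : s'.reg 5 = s'.reg 7 ∧ s'.reg 6 = 0 := by
      by_contra h
      exact (searchCond_ne_zero s').2 h he
    exact hI.isSearch hC' this.1 this.2
  · have hcard : (todoCells (s.arr (b + 9)) (s.arr (b + 12)) E (s.reg 5) (s.reg 7)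
        (s.reg 3)).card ≤ E :=
      (Finset.card_filter_le _ _).trans (Finset.card_range _).le
    rw [mul_right_comm]
    exact Nat.mul_le_mul_right _ (by omega)

theorem Reaches.assign (x : ℕ) (e : Expr) (s : State) :
    Reaches (.assign x e) s (e.cost + 1) (s.setReg x (e.eval s)) :=
  LoopFree.reaches (p := .assign x e) trivial s

theorem exists_reaches_sweep (b : ℕ) (key cand : Expr) : ∃ K, ∀ {n A X N kf C}, IsInput n A X N →
    (∀ v < n, kf v ≤ n) → (∀ s : State, s.reg 0 = n → s.arr 0 = X → key.eval s = kf (s.reg 2)) →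
    (∀ i < n, C i < n) → (∀ v < n, ∃ i < n, C i = v) →
    ∀ s : State, s.reg 0 = n → s.arr 0 = X → s.arr 1 = N →
      (∀ s' : State, (∀ a < b + 4, s'.arr a = s.arr a) → cand.eval s' = C (s'.reg 6)) →
      (∀ k, s.arr (b + 7) k = 0) → (∀ k, s.arr (b + 11) k = 0) → (∀ v, s.arr (b + 15) v = 0) →
      ∃ s', Reaches (sweep b key cand) s (K * (n + X n + 1)) s' ∧
        IsSearch n A kf C (s'.arr (b + 12)) (s'.arr (b + 13)) (s'.arr (b + 14)) := by
  obtain ⟨K₁, hfill⟩ := exists_reaches_fill b key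
  obtain ⟨K₂, hempty⟩ := exists_reaches_empty b
  obtain ⟨K₃, hsearch⟩ := exists_reaches_search b cand
  refine ⟨K₁ + K₂ + K₃ + 17, fun {n A X N kf C} hX hkf hkey hC hC' s h0 hX0 hN hcand hz₇ hz₁₁
    hz₁₅ => ?_⟩
  obtain ⟨s₁, r₁, hB⟩ := hfill hX hkey ((s.setReg 2 0).setReg 3 0) h0 hX0 rfl rfl hz₇
  have hf₁ : ∀ a, ¬ (fillBody b key).SetsArr a → s₁.arr a = s.arr a := fun a ha => r₁.arr_eq ha
  have h0₁ : s₁.reg 0 = n :=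
    (r₁.reg_eq (by simp [SetsReg, fillBody])).trans (by simpa using h0)
  obtain ⟨s₂, r₂, E, hE, hS⟩ := hempty (kf := kf) hX hkf
    (((s₁.setReg 2 0).setReg 3 (s₁.arr (b + 7) 0)).setReg 4 0) h0₁
    ((hf₁ 1 (by simp [SetsArr, fillBody])).trans hN) hB rfl rfl rfl
    (fun k => by simpa [hf₁ (b + 11) (by simp [SetsArr, fillBody])] using hz₁₁ k)
  have hf₂ : ∀ a, ¬ (emptyBody b).SetsArr a → s₂.arr a = s₁.arr a := fun a ha => r₂.arr_eq ha
  have h0₂ : s₂.reg 0 = n :=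
    (r₂.reg_eq (by simp [SetsReg, emptyBody])).trans (by simpa using h0₁)
  obtain ⟨s₃, r₃, hR⟩ := hsearch hX hC hC' hE (((s₂.setReg 5 0).setReg 6 n).setReg 7 0) hS
    (fun s' hs' => hcand s' fun a ha => by
      rw [hs' a ha]
      simp only [State.setReg_arr]
      rw [hf₂, hf₁] <;> simp [SetsArr, fillBody, emptyBody] <;> omega) rfl rfl rfl
    (fun k => by
      have h₁ := hf₂ (b + 15) (by simp [SetsArr, emptyBody])
      have h₂ := hf₁ (b + 15) (by simp [SetsArr, fillBody])
      simpa [h₁, h₂] using hz₁₅ k)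
  refine ⟨s₃, ?_, hR⟩
  have q₁ := Reaches.assign 2 (.const 0) s
  have q₂ := Reaches.assign 3 (.const 0) (s.setReg 2 0)
  have q₃ := Reaches.assign 2 (.const 0) s₁
  have q₄ := Reaches.assign 3 (.get (b + 7) (.const 0)) (s₁.setReg 2 0)
  have q₅ := Reaches.assign 4 (.const 0) ((s₁.setReg 2 0).setReg 3 (s₁.arr (b + 7) 0))
  have q₆ := Reaches.assign 5 (.const 0) s₂
  have q₇ := Reaches.assign 6 (.reg 0) (s₂.setReg 5 0)
  have q₈ := Reaches.assign 7 (.const 0) ((s₂.setReg 5 0).setReg 6 n)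
  have h6 : (Expr.reg 0).eval (s₂.setReg 5 0) = n := by simpa [Expr.eval] using h0₂
  rw [h6] at q₇
  refine (q₁.seq <| q₂.seq <| r₁.seq <| q₃.seq <| q₄.seq <| q₅.seq <| r₂.seq <| q₆.seq <|
    q₇.seq <| q₈.seq r₃).mono ?_
  simp only [Expr.cost]
  have : (K₁ + K₂ + K₃ + 17) * (n + X n + 1) = K₁ * (n + X n + 1) + K₂ * (n + X n + 1) +
    K₃ * (n + X n + 1) + 17 * (n + X n + 1) := by ring
  omega

/-! ### The program of the dynamic program

The positions found by the second search are in the arrays `24`, `25` and `26`. -/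

/-- Computes the entry of the table `b` (array `29`) at `p + 1`, where `p` is in register `2`. -/
def tableBodyB : Prog :=
  .ite (.lt (.get 25 (.reg 2)) (.reg 2))
    (.assign 8 (.get 28 (.get 25 (.sub (.reg 2) (.const 1)))) ;;
     .assign 9 (.get 29 (.get 25 (.reg 2))) ;;
     .ite (.lt (.reg 8) (.reg 9))
       (.store 29 (.add (.reg 2) (.const 1)) (.add (.reg 9) (.const 1)))
       (.store 29 (.add (.reg 2) (.const 1)) (.add (.reg 8) (.const 1))))
    (.store 29 (.add (.reg 2) (.const 1)) (.get 29 (.reg 2)))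

/-- Computes the entry of the table `a` (array `28`) at `p + 1`, where `p` is in register `2`. -/
def tableBodyA : Prog :=
  .assign 3 (.sub (.get 26 (.reg 2)) (.const 1)) ;;
  .ite (.lt (.reg 2) (.reg 3))
    (.assign 8 (.get 28 (.get 25 (.reg 2))) ;;
     .assign 9 (.get 29 (.get 25 (.reg 3))) ;;
     .ite (.lt (.reg 8) (.reg 9))
       (.store 28 (.add (.reg 2) (.const 1)) (.add (.reg 9) (.const 1)))
       (.store 28 (.add (.reg 2) (.const 1)) (.add (.reg 8) (.const 1))))
    (.store 28 (.add (.reg 2) (.const 1)) (.get 28 (.reg 2)))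

/-- One round of the loop that computes the tables: the entries at `p + 1`, then the step from `p`
to `p + 1`. -/
def tableBody : Prog :=
  tableBodyB ;; tableBodyA ;; .assign 2 (.add (.reg 2) (.const 1))

theorem tableBodyB_final (s : State) : (tableBodyB.final s).arr 29 =
    Function.update (s.arr 29) (s.reg 2 + 1) (if s.arr 25 (s.reg 2) < s.reg 2 then
      max (s.arr 28 (s.arr 25 (s.reg 2 - 1))) (s.arr 29 (s.arr 25 (s.reg 2))) + 1
      else s.arr 29 (s.reg 2)) := by
  by_cases h₁ : s.arr 25 (s.reg 2) < s.reg 2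
  · by_cases h₂ : s.arr 28 (s.arr 25 (s.reg 2 - 1)) < s.arr 29 (s.arr 25 (s.reg 2))
    · simp [tableBodyB, final, Expr.eval, h₁, h₂, max_eq_right h₂.le]
    · simp [tableBodyB, final, Expr.eval, h₁, h₂, max_eq_left (not_lt.1 h₂)]
  · simp [tableBodyB, final, Expr.eval, h₁]

theorem tableBodyA_final (s : State) : (tableBodyA.final s).arr 28 =
    Function.update (s.arr 28) (s.reg 2 + 1) (if s.reg 2 < s.arr 26 (s.reg 2) - 1 then
      max (s.arr 28 (s.arr 25 (s.reg 2))) (s.arr 29 (s.arr 25 (s.arr 26 (s.reg 2) - 1))) + 1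
      else s.arr 28 (s.reg 2)) := by
  by_cases h₁ : s.reg 2 < s.arr 26 (s.reg 2) - 1
  · by_cases h₂ : s.arr 28 (s.arr 25 (s.reg 2)) < s.arr 29 (s.arr 25 (s.arr 26 (s.reg 2) - 1))
    · simp [tableBodyA, final, Expr.eval, h₁, h₂, max_eq_right h₂.le]
    · simp [tableBodyA, final, Expr.eval, h₁, h₂, max_eq_left (not_lt.1 h₂)]
  · simp [tableBodyA, final, Expr.eval, h₁]

/-- There are positions left. -/
def tableCond : Expr := .lt (.reg 2) (.reg 0)

theorem tableBodyA_loopFree : tableBodyA.LoopFree := by simp [tableBodyA, LoopFree]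

theorem tableBodyB_loopFree : tableBodyB.LoopFree := by simp [tableBodyB, LoopFree]

theorem tableBody_loopFree : tableBody.LoopFree :=
  ⟨tableBodyB_loopFree, tableBodyA_loopFree, trivial⟩

theorem exists_reaches_table : ∃ K, ∀ {n L R}, IsRange n L R → ∀ s : State, s.reg 0 = n →
    s.arr 25 = L → s.arr 26 = R → s.reg 2 = 0 → s.arr 28 0 = 0 → s.arr 29 0 = 0 →
    ∃ s', Reaches (.loop tableCond tableBody) s (K * (n + 1)) s' ∧
      IsTable n L R (s'.arr 28) (s'.arr 29) := by
  refine ⟨tableCond.cost + 1 + tableBody.maxTime, fun {n L R} hR s h0 h25 h26 h2 ha hb => ?_⟩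
  obtain ⟨s', hs', ⟨h0', -, -, hn, hI⟩, he⟩ := exists_reaches_loop tableBody_loopFree
    (e := tableCond)
    (fun s => s.reg 0 = n ∧ s.arr 25 = L ∧ s.arr 26 = R ∧ s.reg 2 ≤ n ∧
      IsTable (s.reg 2) L R (s.arr 28) (s.arr 29))
    (fun s => n - s.reg 2)
    (by
      rintro s ⟨h0, h25, h26, hn, hI⟩ he
      have hp : s.reg 2 < n := by simpa [tableCond, Expr.eval, h0] using he
      have fB : ∀ a, ¬ tableBodyB.SetsArr a → (tableBodyB.final s).arr a = s.arr a :=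
        fun a ha => tableBodyB_loopFree.final_arr ha s
      have fA : ∀ a, ¬ tableBodyA.SetsArr a →
          (tableBodyA.final (tableBodyB.final s)).arr a = (tableBodyB.final s).arr a :=
        fun a ha => tableBodyA_loopFree.final_arr ha _
      have gB : ∀ x, ¬ tableBodyB.SetsReg x → (tableBodyB.final s).reg x = s.reg x :=
        fun a ha => tableBodyB_loopFree.final_reg ha s
      have gA : ∀ x, ¬ tableBodyA.SetsReg x →
          (tableBodyA.final (tableBodyB.final s)).reg x = (tableBodyB.final s).reg x :=
        fun a ha => tableBodyA_loopFree.final_reg ha _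
      have r₀ : (tableBodyA.final (tableBodyB.final s)).reg 0 = s.reg 0 := by
        rw [gA, gB] <;> simp [tableBodyA, tableBodyB, SetsReg]
      have r₂ : (tableBodyB.final s).reg 2 = s.reg 2 := by
        rw [gB]
        simp [tableBodyB, SetsReg]
      have r₂' : (tableBodyA.final (tableBodyB.final s)).reg 2 = s.reg 2 := by
        rw [gA, r₂]
        simp [tableBodyA, SetsReg]
      have r₂₅ : (tableBodyB.final s).arr 25 = s.arr 25 := fB 25 (by simp [tableBodyB, SetsArr])
      have r₂₆ : (tableBodyB.final s).arr 26 = s.arr 26 := fB 26 (by simp [tableBodyB, SetsArr])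
      have r₂₈ : (tableBodyB.final s).arr 28 = s.arr 28 := fB 28 (by simp [tableBodyB, SetsArr])
      have r₂₅' := fA 25 (by simp [tableBodyA, SetsArr])
      have r₂₆' := fA 26 (by simp [tableBodyA, SetsArr])
      have r₂₉' := fA 29 (by simp [tableBodyA, SetsArr])
      have hA := tableBodyA_final (tableBodyB.final s)
      have hB := tableBodyB_final s
      simp only [r₂, r₂₅, r₂₆, r₂₈, h25, h26] at hA hB
      have key := hI.succ hR hp hB hA
      simp only [tableBody, final, Expr.eval, State.setReg_reg, State.setReg_arr, r₀, r₂', r₂₅',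
        r₂₆', r₂₉', r₂₅, r₂₆, h25, h26, h0, if_true]
      exact ⟨⟨by simp, trivial, trivial, hp, key⟩, by omega⟩)
    s ⟨h0, h25, h26, by omega, by
      rw [h2]
      exact ⟨ha, hb, fun p hp => by omega, fun p hp => by omega⟩⟩
  refine ⟨s', hs'.mono ?_, ?_⟩
  · rw [mul_comm]
    exact Nat.mul_le_mul_left _ (by omega)
  · have : s'.reg 2 = n := le_antisymm hn (by simpa [tableCond, Expr.eval, h0'] using he)
    rwa [this] at hI

/-! ### The program that lists the edges -/

/-- Puts the ends of the rightmost edge allowed by the state of the construction into the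
registers `3` and `4`.  The current bound minus one is in register `2`, and register `5` tells
whether it applies to left ends or to right ends. -/
def pickBody : Prog :=
  .assign 2 (.sub (.reg 2) (.const 1)) ;;
  .ite (.reg 5)
    (.assign 3 (.reg 2) ;; .assign 4 (.sub (.get 26 (.reg 2)) (.const 1)))
    (.assign 3 (.sub (.reg 2) (.const 1)) ;; .assign 4 (.reg 2))

/-- If the positions in the registers `3` and `4` are the ends of an edge, this edge is
appended to the output. -/
def emitBody : Prog :=
  .ite (.sub (.lt (.reg 3) (.reg 4)) (.lt (.reg 3) (.get 25 (.reg 4))))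
    (.store 2 (.reg 1) (.get 24 (.reg 3)) ;;
     .store 3 (.reg 1) (.get 24 (.reg 4)) ;;
     .assign 1 (.add (.reg 1) (.const 1)) ;;
     .ite (.lt (.get 28 (.get 25 (.reg 3))) (.get 29 (.get 25 (.reg 4))))
       (.assign 2 (.get 25 (.reg 4)) ;; .assign 5 (.const 0))
       (.assign 2 (.get 25 (.reg 3)) ;; .assign 5 (.const 1)))
    .skip

/-- One round of the loop that lists the edges. -/
def outputBody : Prog := pickBody ;; emitBody

theorem outputBody_loopFree : outputBody.LoopFree := by
  simp [outputBody, pickBody, emitBody, LoopFree]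

/-- The first cells of the arrays `o₁` and `o₂` hold the ends of the edges in `l`. -/
def IsListed (Q : ℕ → ℕ) (l : List (ℕ × ℕ)) (o₁ o₂ : ℕ → ℕ) : Prop :=
  ∀ (i : ℕ) (hi : i < l.length), o₁ i = Q l[i].1 ∧ o₂ i = Q l[i].2

theorem IsListed.append {Q : ℕ → ℕ} {l : List (ℕ × ℕ)} {o₁ o₂ : ℕ → ℕ} (h : IsListed Q l o₁ o₂)
    (u v : ℕ) : IsListed Q (l ++ [(u, v)]) (Function.update o₁ l.length (Q u))
      (Function.update o₂ l.length (Q v)) := by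
  intro i hi
  rw [List.length_append, List.length_singleton] at hi
  rcases Nat.lt_succ_iff_lt_or_eq.1 hi with hi | rfl
  · rw [Function.update_of_ne (by omega), Function.update_of_ne (by omega),
      List.getElem_append_left hi]
    exact h i hi
  · simp

/-- The invariant of the loop that lists the edges. -/
def IsOutputting (n : ℕ) (Q L a b : ℕ → ℕ) (s : State) : Prop :=
  ∃ l, IsPartial n L a b (s.reg 2) (s.reg 5) l ∧ s.reg 1 = l.length ∧
    IsListed Q l (s.arr 2) (s.arr 3)

theorem isOutputting_emitBody {n : ℕ} {Q L R a b : ℕ → ℕ} (hR : IsRange n L R) {s : State}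
    (hQ : s.arr 24 = Q) (hL : s.arr 25 = L) (ha : s.arr 28 = a) (hb : s.arr 29 = b) {p m : ℕ}
    {l : List (ℕ × ℕ)} (h : IsPartial n L a b p m l) (hlen : s.reg 1 = l.length)
    (hlist : IsListed Q l (s.arr 2) (s.arr 3)) (he : IsEdge n L (s.reg 3, s.reg 4))
    (hum : m ≠ 0 → s.reg 3 < p) (hvm : m = 0 → s.reg 4 < p)
    (hval : (if m = 0 then b p else a p) = max (a (L (s.reg 3))) (b (L (s.reg 4))) + 1) :
    IsOutputting n Q L a b (emitBody.final s) ∧ (emitBody.final s).reg 2 ≤ s.reg 3 := by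
  obtain ⟨h₁, h₂⟩ := h.choose hR he hum hvm hval
  obtain ⟨huv, hv, hLv⟩ := he
  simp only at huv hv hLv
  have hLu := hR.le (s.reg 3) (by omega)
  have hLv' := not_lt.2 hLv
  by_cases hlt : a (L (s.reg 3)) < b (L (s.reg 4))
  · simp [IsOutputting, emitBody, final, Expr.eval, huv, hLv', hQ, hL, ha, hb, hlt, hlen]
    exact ⟨⟨_, h₁ hlt, by simp, hlist.append _ _⟩, hLv⟩
  · simp [IsOutputting, emitBody, final, Expr.eval, huv, hLv', hQ, hL, ha, hb, hlt, hlen]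
    exact ⟨⟨_, h₂ hlt, by simp, hlist.append _ _⟩, hLu⟩

theorem emitBody_final_of_not {s : State}
    (h : ¬ (s.reg 3 < s.reg 4 ∧ s.arr 25 (s.reg 4) ≤ s.reg 3)) : emitBody.final s = s := by
  refine if_pos ?_
  by_cases h₁ : s.reg 3 < s.reg 4 <;> by_cases h₂ : s.reg 3 < s.arr 25 (s.reg 4) <;>
    simp [Expr.eval, h₁, h₂]
  omega

theorem exists_reaches_output : ∃ K, ∀ {n Q L R a b}, IsRange n L R → IsTable n L R a b →
    ∀ s : State, s.reg 1 = 0 → s.reg 2 = n → s.reg 5 = 0 → s.arr 24 = Q → s.arr 25 = L →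
    s.arr 26 = R → s.arr 28 = a → s.arr 29 = b →
    ∃ s' l, Reaches (.loop (.reg 2) outputBody) s (K * (n + 1)) s' ∧ (∀ e ∈ l, IsEdge n L e) ∧
      (l.Pairwise fun f e => PosBefore L e f) ∧ l.length = b n ∧ s'.reg 1 = l.length ∧
      IsListed Q l (s'.arr 2) (s'.arr 3) := by
  refine ⟨(Expr.reg 2).cost + 1 + outputBody.maxTime,
    fun {n Q L R a b} hR ht s h1 h2 h5 h24 h25 h26 h28 h29 => ?_⟩
  obtain ⟨s', hs', ⟨-, -, -, -, -, l, hl, hlen, hlist⟩, he⟩ :=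
    exists_reaches_loop outputBody_loopFree (e := .reg 2)
    (fun s => s.arr 24 = Q ∧ s.arr 25 = L ∧ s.arr 26 = R ∧ s.arr 28 = a ∧ s.arr 29 = b ∧
      IsOutputting n Q L a b s)
    (fun s => s.reg 2)
    (by
      rintro s ⟨h24, h25, h26, h28, h29, l, hl, hlen, hlist⟩ he
      have f : ∀ a, ¬ outputBody.SetsArr a → (outputBody.final s).arr a = s.arr a :=
        fun a ha => outputBody_loopFree.final_arr ha s
      rw [f 24, f 25, f 26, f 28, f 29]
      rotate_left
      iterate 5 simp [outputBody, pickBody, emitBody, SetsArr]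
      obtain ⟨p, hp⟩ := Nat.exists_eq_succ_of_ne_zero (show s.reg 2 ≠ 0 from he)
      rw [hp] at hl
      have hpn : p < n := hl.le
      suffices IsOutputting n Q L a b (outputBody.final s) ∧ (outputBody.final s).reg 2 ≤ p from
        ⟨⟨h24, h25, h26, h28, h29, this.1⟩, by omega⟩
      rw [show outputBody.final s = emitBody.final (pickBody.final s) from rfl]
      by_cases hm : s.reg 5 = 0
      · have hpick : pickBody.final s = ((s.setReg 2 p).setReg 3 (p - 1)).setReg 4 p := by
          simp [pickBody, final, Expr.eval, hp, hm]
        rw [hpick]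
        by_cases hLp : L p < p
        · have := isOutputting_emitBody hR (s := ((s.setReg 2 p).setReg 3 (p - 1)).setReg 4 p)
            h24 h25 h28 h29 hl (by simpa using hlen) hlist
            (by simp [IsEdge]; omega) (fun h => absurd hm h) (by simp)
            (by simp [hm, ht.b_succ p hpn, hLp])
          refine ⟨this.1, this.2.trans ?_⟩
          simp
        · rw [emitBody_final_of_not (by simp [h25]; omega)]
          exact ⟨⟨l, by simpa using hl.skip_of_zero ht hm hLp, by simpa using hlen, hlist⟩, by simp⟩
      · have hpick : pickBody.final s = ((s.setReg 2 p).setReg 3 p).setReg 4 (R p - 1) := by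
          simp [pickBody, final, Expr.eval, hp, hm, h26]
        rw [hpick]
        have hRn := hR.R_le p hpn
        by_cases hRp : p < R p - 1
        · have hLR : L (R p - 1) ≤ p := (hR.lt_R_iff p hpn (R p - 1) (by omega)).1 (by omega)
          have := isOutputting_emitBody hR (s := ((s.setReg 2 p).setReg 3 p).setReg 4 (R p - 1))
            h24 h25 h28 h29 hl (by simpa using hlen) hlist
            (by simp [IsEdge]; omega) (by simp) (fun h => absurd h hm)
            (by simp [hm, ht.a_succ p hpn, hRp])
          refine ⟨this.1, this.2.trans ?_⟩
          simp
        · rw [emitBody_final_of_not (by simp; omega)]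
          exact ⟨⟨l, by simpa using hl.skip_of_ne ht hm hRp, by simpa using hlen, hlist⟩, by simp⟩)
    s ⟨h24, h25, h26, h28, h29, [], by rw [h2, h5]; exact .nil, h1, fun i hi => by simp at hi⟩
  have he : s'.reg 2 = 0 := he
  rw [he] at hl
  refine ⟨s', l, hs'.mono ?_, hl.isEdge, hl.pairwise, hl.length_eq ht, hlen, hlist⟩
  rw [mul_comm]
  exact Nat.mul_le_mul_left _ (by omega)

/-! ### The input -/

/-- The adjacency relation of a graph on `Fin n`, as a relation on natural numbers. -/
def natAdj {n : ℕ} (G : SimpleGraph (Fin n)) (u v : ℕ) : Prop :=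
  ∃ (hu : u < n) (hv : v < n), G.Adj ⟨u, hu⟩ ⟨v, hv⟩

section Input

variable {n : ℕ} {G : SimpleGraph (Fin n)} {nbrs : Fin n → List (Fin n)}

theorem inputState_offset_succ (nbrs : Fin n → List (Fin n)) (v : Fin n) :
    (inputState nbrs).arr 0 (v + 1) = (inputState nbrs).arr 0 v + (nbrs v).length := by
  have h₁ : (v : ℕ) + 1 ≤ n := v.2
  have h₂ : (v : ℕ) ≤ n := v.2.le
  simp only [inputState, if_true, h₁, h₂]
  rw [List.take_add_one, List.getElem?_eq_getElem (by simp)]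
  simp

theorem inputState_target (nbrs : Fin n → List (Fin n)) (v : Fin n) (i : ℕ)
    (hi : i < (nbrs v).length) :
    (inputState nbrs).arr 1 ((inputState nbrs).arr 0 v + i) = (nbrs v)[i] := by
  have h₂ : (v : ℕ) ≤ n := v.2.le
  simp only [inputState, if_true, h₂, one_ne_zero, if_false]
  have hsplit : List.ofFn nbrs =
      (List.ofFn nbrs).take v ++ nbrs v :: (List.ofFn nbrs).drop (v + 1) := by
    have h := List.drop_eq_getElem_cons (l := List.ofFn nbrs) (i := v) (by simp)
    rw [List.getElem_ofFn] at h
    exact (List.take_append_drop v _).symm.trans (by rw [h])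
  have hflat : (List.ofFn nbrs).flatten = ((List.ofFn nbrs).take v).flatten ++
      (nbrs v ++ ((List.ofFn nbrs).drop (v + 1)).flatten) := by
    rw [← List.flatten_cons, ← List.flatten_append, ← hsplit]
  rw [List.getD_eq_getElem?_getD, List.getElem?_map, hflat,
    List.getElem?_append_right (Nat.le_add_right _ _), Nat.add_sub_cancel_left,
    List.getElem?_append_left hi, List.getElem?_eq_getElem hi]
  rfl

theorem IsAdjacencyList.length_eq (h : IsAdjacencyList G nbrs) (v : Fin n) :
    (nbrs v).length = (G.neighborSet v).ncard := by
  classical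
  rw [← List.toFinset_card_of_nodup (h v).1, ← Set.ncard_coe_finset]
  congr 1
  ext w
  simp [(h v).2 w]

theorem IsAdjacencyList.isInput (h : IsAdjacencyList G nbrs) :
    IsInput n (natAdj G) ((inputState nbrs).arr 0) ((inputState nbrs).arr 1) where
  symm := fun u v ⟨hu, hv, huv⟩ => ⟨hv, hu, huv.symm⟩
  lt := fun u v ⟨hu, _⟩ => hu
  zero := by simp [inputState]
  le_succ v hv := by
    rw [inputState_offset_succ nbrs ⟨v, hv⟩]
    exact Nat.le_add_right _ _
  adj v hv q hq hq' := by
    rw [inputState_offset_succ nbrs ⟨v, hv⟩] at hq'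
    obtain ⟨i, rfl⟩ := Nat.exists_eq_add_of_le hq
    have hi : i < (nbrs ⟨v, hv⟩).length := by simpa using hq'
    rw [inputState_target nbrs ⟨v, hv⟩ i hi]
    exact ⟨hv, Fin.is_lt _, ((h _).2 _).1 (List.getElem_mem hi)⟩
  exists_of_adj := fun u v ⟨hu, hv, huv⟩ => by
    obtain ⟨i, hi, hiv⟩ := List.getElem_of_mem (((h _).2 _).2 huv)
    refine ⟨(inputState nbrs).arr 0 u + i, Nat.le_add_right _ _, ?_, ?_⟩
    · rw [inputState_offset_succ nbrs ⟨u, hu⟩]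
      simpa using hi
    · rw [inputState_target nbrs ⟨u, hu⟩ i hi, hiv]

theorem IsAdjacencyList.offset_last (h : IsAdjacencyList G nbrs) :
    (inputState nbrs).arr 0 n = 2 * G.edgeSet.ncard := by
  classical
  have h₁ : (inputState nbrs).arr 0 n = ∑ v, (nbrs v).length := by
    simp only [inputState, if_true, le_refl]
    rw [List.take_of_length_le (by simp), List.length_flatten, List.map_ofFn, List.sum_ofFn]
    rfl
  rw [h₁, ← SimpleGraph.coe_edgeFinset, Set.ncard_coe_finset,
    ← SimpleGraph.sum_degrees_eq_twice_card_edges]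
  refine Finset.sum_congr rfl fun v _ => ?_
  rw [h.length_eq, ← SimpleGraph.card_neighborFinset_eq_degree, ← Set.ncard_coe_finset,
    SimpleGraph.coe_neighborFinset]

theorem IsAdjacencyList.boundedBy (h : IsAdjacencyList G nbrs) :
    (inputState nbrs).BoundedBy (n + (inputState nbrs).arr 0 n) := by
  refine ⟨fun x => ?_, fun a k => ?_⟩
  · simp only [inputState]
    split_ifs <;> omega
  · by_cases h0 : a = 0
    · subst h0
      by_cases hk : k ≤ n
      · exact (h.isInput.mono hk le_rfl).trans (Nat.le_add_left _ _)
      · simp [inputState, hk]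
    · by_cases h1 : a = 1
      · simp only [inputState, h1, if_true, if_false, one_ne_zero]
        rw [List.getD_eq_getElem?_getD]
        by_cases hk : k < ((List.ofFn nbrs).flatten.map Fin.val).length
        · rw [List.getElem?_eq_getElem hk, Option.getD_some, List.getElem_map]
          exact (Fin.is_lt _).le.trans (Nat.le_add_right _ _)
        · rw [List.getElem?_eq_none (not_lt.1 hk)]
          exact Nat.zero_le _
      · simp [inputState, h0, h1]

end Input

/-! ### Correctness of the algorithm -/

theorem IsSearch.isRange {n : ℕ} {A : ℕ → ℕ → Prop} {kf C Q L R : ℕ → ℕ}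
    (h : IsSearch n A kf C Q L R) : IsRange n L R :=
  ⟨h.L_le, h.L_mono, h.R_le, h.lt_R_iff⟩

/-- The result of a search on the machine, as a search order of the graph. -/
theorem IsSearch.exists_isSearchOrder {n : ℕ} {G : SimpleGraph (Fin n)} {kf C Q L R : ℕ → ℕ}
    (h : IsSearch n (natAdj G) kf C Q L R) :
    ∃ (pos : Fin n → ℕ) (par : Fin n → Fin n), G.IsSearchOrder pos par (fun v => kf v) ∧
      (∀ v, pos v < n) ∧ (∀ v, Q (pos v) = v) ∧ (∀ i < n, ∀ v : Fin n, Q i = v → pos v = i) ∧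
      ∀ v, pos (par v) = L (pos v) := by
  have hinj' : ∀ i < n, ∀ j < n, Q i = Q j → i = j := by
    intro i hi j hj hij
    rcases lt_trichotomy i j with hlt | heq | hgt
    · exact absurd hij (h.Q_inj i j hlt hj)
    · exact heq
    · exact absurd hij.symm (h.Q_inj j i hgt hi)
  have hsurj : Function.Surjective fun i : Fin n => (⟨Q i, h.Q_lt i i.2⟩ : Fin n) := by
    refine Finite.injective_iff_surjective.1 fun i j hij => Fin.ext ?_
    exact hinj' i i.2 j j.2 (Fin.mk.inj_iff.1 hij)
  choose p hp using hsurj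
  have hQ : ∀ v, Q (p v) = v := fun v => congrArg Fin.val (hp v)
  have hpos : ∀ i < n, ∀ v : Fin n, Q i = v → (p v : ℕ) = i := fun i hi v hv =>
    hinj' _ (p v).2 i hi ((hQ v).trans hv.symm)
  have hL : ∀ v, L (p v) < n := fun v => (h.L_le _ (p v).2).trans_lt (p v).2
  have hpar : ∀ v, (p ⟨Q (L (p v)), h.Q_lt _ (hL v)⟩ : ℕ) = L (p v) := fun v =>
    hpos _ (hL v) _ rfl
  have hadj : ∀ u v : Fin n, natAdj G u v ↔ G.Adj u v := fun u v =>
    ⟨fun ⟨_, _, huv⟩ => huv, fun huv => ⟨u.2, v.2, huv⟩⟩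
  refine ⟨fun v => p v, fun v => ⟨Q (L (p v)), h.Q_lt _ (hL v)⟩, ⟨?_, ?_, ?_, ?_, ?_⟩,
    fun v => (p v).2, hQ, hpos, hpar⟩
  · intro u v huv
    have := hQ u
    simp only at huv
    rw [huv, hQ v] at this
    exact Fin.ext this.symm
  · intro v
    rcases (h.L_le _ (p v).2).lt_or_eq with hlt | heq
    · right
      have := h.adj_L _ (p v).2 hlt
      rw [hQ] at this
      exact (hadj ⟨_, _⟩ v).1 this
    · left
      apply Fin.ext
      simp only [heq, hQ]
  · rintro u v (rfl | huv)
    · rw [hpar]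
      exact h.L_le _ (p v).2
    · rw [hpar]
      refine h.L_le_of_adj _ (p u).2 _ (p v).2 ?_
      rw [hQ, hQ]
      exact (hadj v u).2 huv
  · intro u v huv
    rw [hpar, hpar]
    exact h.L_mono _ _ huv (p v).2
  · intro u v huv heq hne
    have h₁ : L (p u) = L (p v) :=
      (hpar u).symm.trans ((congrArg (fun w => (p w : ℕ)) heq).trans (hpar v))
    have h₂ : L (p u) < p u := by
      refine lt_of_le_of_ne (h.L_le _ (p u).2) fun h' => hne (Fin.ext ?_)
      simp only [h', hQ]
    have := h.siblings _ _ huv (p v).2 h₁ h₂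
    rwa [hQ, hQ] at this

/-- After two searches, the second of which takes its roots from the end of the first, the
vertices are arranged in an umbrella ordering. -/
theorem exists_isLayout {n : ℕ} {G : SimpleGraph (Fin n)} (hG : G.IsProperInterval)
    {kf₁ kf₂ C Q₁ L₁ R₁ Q L R : ℕ → ℕ} (h₁ : IsSearch n (natAdj G) kf₁ C Q₁ L₁ R₁)
    (h₂ : IsSearch n (natAdj G) kf₂ Q₁ Q L R)
    (hk₁ : ∀ x y : Fin n, kf₁ y ≤ kf₁ x → (G.neighborSet y).ncard ≤ (G.neighborSet x).ncard)
    (hk₂ : ∀ x y : Fin n, kf₂ y ≤ kf₂ x → (G.neighborSet x).ncard ≤ (G.neighborSet y).ncard) :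
    ∃ pos lo : Fin n → ℕ, G.IsLayout pos lo ∧ (∀ v, pos v < n) ∧
      (∀ i < n, ∀ v : Fin n, Q i = v → pos v = i) ∧ ∀ v, L (pos v) = lo v := by
  obtain ⟨f, hf⟩ := hG.exists_isUmbrella
  obtain ⟨pos₁, par₁, ho₁, hlt₁, hQ₁, hpos₁, -⟩ := h₁.exists_isSearchOrder
  obtain ⟨pos, par, ho, hlt, hQ, hpos, hpar⟩ := h₂.exists_isSearchOrder
  refine ⟨pos, fun v => pos (par v), ho.isLayout (ho.isUmbrella_pos hk₂ fun s hs => ?_), hlt, hpos,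
    fun v => (hpar v).symm⟩
  refine ho₁.exists_isUmbrella_le_of_last hk₁ hf fun y hy => ?_
  -- The root `s` is visited last in its component by the first search.
  by_contra! hys
  obtain ⟨c, hc, hcs, hlater⟩ := h₂.root (pos s) (hlt s) (by rw [← hpar, hs])
  rw [hQ] at hcs
  rw [hpos₁ c hc s hcs] at hys
  obtain ⟨j, hj, hjy⟩ := hlater (pos₁ y) hys (hlt₁ y)
  rw [hQ₁] at hjy
  have h₃ := hpos j (hj.trans (hlt s)) y hjy
  have h₄ := ho.pos_root_le hs hy
  omega

/-- The degree of the vertex in register `2`. -/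
def degreeExpr : Expr := .sub (.get 0 (.add (.reg 2) (.const 1))) (.get 0 (.reg 2))

/-- The whole algorithm: two searches, the dynamic program, and the output.  The first search visits
siblings by descending degree and takes its roots in any order; the second one visits siblings by
ascending degree and takes its roots from the end of the first. -/
def algorithm : Prog :=
  sweep 0 degreeExpr (.reg 6) ;;
  sweep 12 (.sub (.reg 0) degreeExpr) (.get 12 (.reg 6)) ;;
  .assign 2 (.const 0) ;; .loop tableCond tableBody ;;
  .assign 2 (.reg 0) ;; .assign 5 (.const 0) ;; .loop (.reg 2) outputBody

theorem algorithm_slow : algorithm.Slow := by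
  simp [algorithm, sweep, fillCond, fillBody, emptyCond, emptyBody, searchCond, searchBody,
    tableCond, tableBody, tableBodyA, tableBodyB, outputBody, pickBody, emitBody, degreeExpr,
    Prog.Slow, Expr.Slow]

theorem not_setsArr_sweep {b a : ℕ} {key cand : Expr} (h : a < b + 4 ∨ b + 15 < a) :
    ¬ (sweep b key cand).SetsArr a := by
  simp [sweep, fillBody, emptyBody, searchBody, SetsArr]
  omega

theorem not_setsReg_sweep {b x : ℕ} {key cand : Expr} (h : x ≤ 1) :
    ¬ (sweep b key cand).SetsReg x := by
  simp [sweep, fillBody, emptyBody, searchBody, SetsReg]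
  omega

theorem exists_reaches_algorithm : ∃ K, ∀ {n : ℕ} {G : SimpleGraph (Fin n)}
    {nbrs : Fin n → List (Fin n)}, G.IsProperInterval → IsAdjacencyList G nbrs →
    ∃ (s : State) (M : G.Subgraph),
      Reaches algorithm (inputState nbrs) (K * (n + (inputState nbrs).arr 0 n + 1)) s ∧
      M.IsMaximumUniquelyRestricted ∧ Outputs s M.edgeSet := by
  obtain ⟨K₁, hsweep₁⟩ := exists_reaches_sweep 0 degreeExpr (.reg 6)
  obtain ⟨K₂, hsweep₂⟩ := exists_reaches_sweep 12 (.sub (.reg 0) degreeExpr) (.get 12 (.reg 6))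
  obtain ⟨K₃, htable⟩ := exists_reaches_table
  obtain ⟨K₄, houtput⟩ := exists_reaches_output
  refine ⟨K₁ + K₂ + K₃ + K₄ + 6, fun {n G nbrs} hG hadj => ?_⟩
  set X := (inputState nbrs).arr 0 with hX
  set N := (inputState nbrs).arr 1 with hN
  have hinput : IsInput n (natAdj G) X N := hadj.isInput
  have hdeg : ∀ v : Fin n, X (v + 1) - X v = (G.neighborSet v).ncard := fun v => by
    rw [hX, inputState_offset_succ, hadj.length_eq, Nat.add_sub_cancel_left]
  have hdegn : ∀ v : Fin n, (G.neighborSet v).ncard ≤ n := fun v =>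
    (Set.ncard_le_card _).trans (by simp)
  have hzero : ∀ a, 2 ≤ a → ∀ k, (inputState nbrs).arr a k = 0 := fun a ha k => by
    simp [inputState, show a ≠ 0 by omega, show a ≠ 1 by omega]
  obtain ⟨s₁, r₁, h₁⟩ := hsweep₁ (kf := fun v => X (v + 1) - X v) (C := id) hinput
    (fun v hv => (hdeg ⟨v, hv⟩).le.trans (hdegn _))
    (fun s _ hs => by simp [degreeExpr, Expr.eval, hs]) (fun i hi => hi)
    (fun v hv => ⟨v, hv, rfl⟩) (inputState nbrs) (by simp [inputState]) rfl rfl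
    (fun _ _ => rfl) (hzero _ (by omega)) (hzero _ (by omega)) (hzero _ (by omega))
  have hf₁ : ∀ a, a < 4 ∨ 15 < a → s₁.arr a = (inputState nbrs).arr a := fun a ha =>
    r₁.arr_eq (not_setsArr_sweep (by omega))
  have hg₁ : ∀ x ≤ 1, s₁.reg x = (inputState nbrs).reg x := fun x hx =>
    r₁.reg_eq (not_setsReg_sweep hx)
  have hsurj : ∀ v < n, ∃ i < n, s₁.arr 12 i = v := fun v hv => by
    obtain ⟨pos, par, -, hlt, hQ, -⟩ := h₁.exists_isSearchOrder
    exact ⟨pos ⟨v, hv⟩, hlt _, hQ _⟩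
  obtain ⟨s₂, r₂, h₂⟩ := hsweep₂ (kf := fun v => n - (X (v + 1) - X v)) (C := s₁.arr 12) hinput
    (fun v _ => Nat.sub_le _ _)
    (fun s hs hs' => by simp [degreeExpr, Expr.eval, hs, hs']) h₁.Q_lt hsurj s₁
    ((hg₁ 0 (by omega)).trans (by simp [inputState])) (hf₁ 0 (by omega)) (hf₁ 1 (by omega))
    (fun s' hs' => by simp [Expr.eval, hs' 12 (by omega)])
    (fun k => by rw [hf₁ _ (by omega)]; exact hzero _ (by omega) k)
    (fun k => by rw [hf₁ _ (by omega)]; exact hzero _ (by omega) k)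
    (fun k => by rw [hf₁ _ (by omega)]; exact hzero _ (by omega) k)
  have hf₂ : ∀ a, a < 4 ∨ 27 < a → s₂.arr a = (inputState nbrs).arr a := fun a ha =>
    (r₂.arr_eq (not_setsArr_sweep (by omega))).trans (hf₁ a (by omega))
  have hg₂ : ∀ x ≤ 1, s₂.reg x = (inputState nbrs).reg x := fun x hx =>
    (r₂.reg_eq (not_setsReg_sweep hx)).trans (hg₁ x hx)
  have hreg₂ : s₂.reg 0 = n := (hg₂ 0 (by omega)).trans (by simp [inputState])
  obtain ⟨s₃, r₃, h₃⟩ := htable h₂.isRange (s₂.setReg 2 0) hreg₂ rfl rfl rfl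
    (by rw [State.setReg_arr, hf₂ _ (by omega)]; exact hzero _ (by omega) 0)
    (by rw [State.setReg_arr, hf₂ _ (by omega)]; exact hzero _ (by omega) 0)
  have hf₃ : ∀ a, a ≠ 28 → a ≠ 29 → s₃.arr a = s₂.arr a := fun a ha hb =>
    r₃.arr_eq (by simp [tableBody, tableBodyA, tableBodyB, SetsArr, ha, hb])
  have hg₃ : ∀ x ≤ 1, s₃.reg x = (inputState nbrs).reg x := fun x hx => by
    refine (r₃.reg_eq ?_).trans ?_
    · simp [tableBody, tableBodyA, tableBodyB, SetsReg]
      omega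
    · rw [State.setReg_reg, if_neg (by omega), hg₂ x hx]
  have hreg₃ : s₃.reg 0 = n := (hg₃ 0 (by omega)).trans (by simp [inputState])
  obtain ⟨s₄, l, r₄, hedge, hpair, hlen, hreg, hlist⟩ := houtput h₂.isRange h₃
    ((s₃.setReg 2 n).setReg 5 0) ((hg₃ 1 le_rfl).trans (by simp [inputState])) rfl rfl
    (hf₃ 24 (by omega) (by omega)) (hf₃ 25 (by omega) (by omega)) (hf₃ 26 (by omega) (by omega))
    rfl rfl
  -- The layout of the graph that the two searches have found.
  obtain ⟨pos, lo, hlay, hlt, hpos, hlo⟩ := exists_isLayout hG h₁ h₂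
    (fun x y hxy => by simpa only [hdeg] using hxy)
    (fun x y hxy => by
      have h₁ := hdegn x
      have h₂ := hdegn y
      simp only [hdeg] at hxy
      omega)
  have hQlt := h₂.Q_lt
  set Q := s₂.arr 24 with hQ
  have hH : ∀ e ∈ l, Q e.1 < n ∧ Q e.2 < n := fun e he => by
    obtain ⟨he₁, he₂, -⟩ := hedge e he
    exact ⟨hQlt _ (by omega), hQlt _ he₂⟩
  set l' : List (Fin n × Fin n) := l.pmap (fun e he => (⟨Q e.1, he.1⟩, ⟨Q e.2, he.2⟩)) hH with hl'
  have hpos' : ∀ e (he : e ∈ l), pos ⟨Q e.1, (hH e he).1⟩ = e.1 ∧ pos ⟨Q e.2, (hH e he).2⟩ = e.2 :=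
    fun e he => by
      obtain ⟨he₁, he₂, -⟩ := hedge e he
      exact ⟨hpos _ (by omega) _ rfl, hpos _ he₂ _ rfl⟩
  obtain ⟨M, hM, hnodup, hmem⟩ := hlay.exists_isUniquelyRestricted_of_list (l := l')
    (by
      intro e' he'
      obtain ⟨e, he, rfl⟩ := List.mem_pmap.1 he'
      obtain ⟨h₁, h₂⟩ := hpos' e he
      obtain ⟨he₁, he₂, he₃⟩ := hedge e he
      have hlt : pos ⟨Q e.1, (hH e he).1⟩ < pos ⟨Q e.2, (hH e he).2⟩ := by rwa [h₁, h₂]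
      refine ⟨hlt, (hlay.adj_iff _ _ hlt).2 ?_⟩
      rwa [← hlo, h₁, h₂])
    (by
      rw [hl', List.pairwise_pmap]
      refine hpair.imp_of_mem fun {f e} hf he hfe _ _ => ?_
      simp only [SimpleGraph.Before, ← hlo]
      rw [(hpos' e he).1, (hpos' e he).2, (hpos' f hf).1, (hpos' f hf).2]
      exact hfe)
  have hlen' : l'.length = l.length := List.length_pmap
  have hcard : M.edgeSet.ncard = s₃.arr 29 n := by
    classical
    have : M.edgeSet = ((l'.map fun p => s(p.1, p.2)).toFinset : Set (Sym2 (Fin n))) := by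
      ext e
      rw [hmem, List.coe_toFinset]
      rfl
    rw [this, Set.ncard_coe_finset, List.toFinset_card_of_nodup hnodup, List.length_map, hlen',
      hlen]
  refine ⟨s₄, M, ?_, ⟨hM, fun M' hM' => ?_⟩, l', hnodup, hmem, hreg.trans hlen'.symm, ?_⟩
  · have q₁ := Reaches.assign 2 (.const 0) s₂
    have q₂ := Reaches.assign 2 (.reg 0) s₃
    have q₃ := Reaches.assign 5 (.const 0) (s₃.setReg 2 n)
    rw [show (Expr.reg 0).eval s₃ = n from hreg₃] at q₂
    refine (r₁.seq <| r₂.seq <| q₁.seq <| r₃.seq <| q₂.seq <| q₃.seq r₄).mono ?_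
    simp only [Expr.cost]
    have e₁ : (K₁ + K₂ + K₃ + K₄ + 6) * (n + X n + 1) = K₁ * (n + X n + 1) + K₂ * (n + X n + 1) +
      K₃ * (n + X n + 1) + K₄ * (n + X n + 1) + 6 * (n + X n + 1) := by ring
    have e₃ : K₃ * (n + 1) ≤ K₃ * (n + X n + 1) := Nat.mul_le_mul_left _ (by omega)
    have e₄ : K₄ * (n + 1) ≤ K₄ * (n + X n + 1) := Nat.mul_le_mul_left _ (by omega)
    omega
  · rw [hcard]
    exact h₃.ncard_edgeSet_le hlay h₂.isRange hlt hlo hM'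
  · intro i hi
    have := hlist i (hlen' ▸ hi)
    simpa only [hl', List.getElem_pmap] using this

end RAM

theorem mainTheorem4 :
    ∃ (P : RAM.Prog) (c : ℕ),
      ∀ (n : ℕ) (G : SimpleGraph (Fin n)) (nbrs : Fin n → List (Fin n)),
        G.IsProperInterval → RAM.IsAdjacencyList G nbrs →
          ∃ (t : ℕ) (s : RAM.State) (M : G.Subgraph),
            RAM.Exec (c * (n + G.edgeSet.ncard + 1)) P (RAM.inputState nbrs) t s ∧
            t ≤ c * (n + G.edgeSet.ncard + 1) ∧
            M.IsMaximumUniquelyRestricted ∧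
            RAM.Outputs s M.edgeSet := by
  obtain ⟨K, h⟩ := RAM.exists_reaches_algorithm
  refine ⟨RAM.algorithm, 2 * K + 2, fun n G nbrs hG hadj => ?_⟩
  obtain ⟨s, M, ⟨t, ht, W, hexec⟩, hM, hout⟩ := h hG hadj
  have hexec' := (hexec.of_slow RAM.algorithm_slow hadj.boundedBy).1
  rw [hadj.offset_last] at ht hexec'
  have hK : K * (n + 2 * G.edgeSet.ncard + 1) ≤ 2 * K * (n + G.edgeSet.ncard + 1) := by
    calc K * (n + 2 * G.edgeSet.ncard + 1) ≤ K * (2 * (n + G.edgeSet.ncard + 1)) :=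
          Nat.mul_le_mul_left _ (by omega)
      _ = _ := by ring
  have hc : (2 * K + 2) * (n + G.edgeSet.ncard + 1) =
      2 * K * (n + G.edgeSet.ncard + 1) + 2 * (n + G.edgeSet.ncard + 1) := by ring
  exact ⟨t, s, M, hexec'.mono (by omega), by omega, hM, hout⟩
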